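/- For integers $n\ge 1$ and $1\le k\le n$ let $\theta_k^{(n)}=\frac{2k-1}{2n}\pi$, let \[P_k(t)=(-1)^{k+1}\frac{\cos(nt)\,\sin\theta_k^{(n)}}{n(\cos t-\cos\theta_k^{(n)})}\] (with the limiting value $1$ where $\cos t=\cos\theta_k^{(n)}$), and let \[S_{k,n}(t)=\tfrac12\Big(P_k\big(t-\tfrac{\pi}{2n}\big)+P_k\big(t+\tfrac{\pi}{2n}\big)\Big).\] For $f\in C[0,\pi]$ and $\theta\in[0,\pi]$ define the Grünwald–Durrmeyer operators and the weighted first moment by \[\mathcal D_n(f)(\theta)=\frac n\pi\sum_{k=1}^n S_{k,n}(\theta)\int_0^\pi f(t)S_{k,n}(t)\,dt,\qquad \delta_n(\theta)=\frac n\pi\sum_{k=1}^n |S_{k,n}(\theta)|\int_0^\pi |t-\theta_k^{(n)}|\,|S_{k,n}(t)|\,dt .\] For a continuous real function $g$ on a compact interval $I$ and $\delta\ge 0$ let $\omega(g,\delta)=\sup\{|g(s)-g(t)|: s,t\in I,\ |s-t|\le\delta\}$; here $f$ is taken on $[0,\pi]$ and $f\circ\arccos$ on $[-1,1]$. **Theorem.**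 There is an absolute constant $C>0$ such that for every real-valued $f\in C[0,\pi]$, every $n\ge1$ and every $\theta\in[0,\pi]$, with $x=\cos\theta$, \[|\mathcal D_n(f)(\theta)-f(\theta)|\le C\left(\omega(f,\delta_n(\theta))+\omega\Big(f\circ\arccos,\frac{\sqrt{1-x^2}}{n}\Big)+\omega\Big(f\circ\arccos,\frac1{n^2}\Big)\right).\] Moreover, there is an absolute constant $C'>0$ such that $\delta_n(\theta)\le C'\,\frac{1+\log n}{n}$ for all $n\ge 1$ and $\theta\in[0,\pi]$. -/

import Mathlib

open Set

noncomputable section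

/-- The Chebyshev angle `θ_k^{(n)} = (2k-1)π/(2n)`, used for `1 ≤ k ≤ n`. -/
def chebAngle (n k : ℕ) : ℝ := (2 * (k : ℝ) - 1) / (2 * (n : ℝ)) * Real.pi

/-- The fundamental Lagrange function
`P_k(t) = (-1)^{k+1} cos(nt) sin θ_k / (n (cos t - cos θ_k))` of the Chebyshev nodes
`x_j = cos θ_j^{(n)}`. The formula has removable singularities where `cos t = cos θ_k`;
there `P_k` takes its limiting value `1`, so that `P_k(t)` is the value at `cos t` of the
Lagrange basis polynomial of the node `x_k`. -/
def lagrangeFun (n k : ℕ) (t : ℝ) : ℝ :=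
  if Real.cos t = Real.cos (chebAngle n k) then 1
  else (-1) ^ (k + 1) * (Real.cos (n * t) * Real.sin (chebAngle n k)) /
    (n * (Real.cos t - Real.cos (chebAngle n k)))

/-- `S_{k,n}(t) = (P_k(t - π/(2n)) + P_k(t + π/(2n))) / 2`. -/
def grunwaldFun (n k : ℕ) (t : ℝ) : ℝ :=
  1 / 2 * (lagrangeFun n k (t - Real.pi / (2 * n)) + lagrangeFun n k (t + Real.pi / (2 * n)))

/-- The Grünwald–Durrmeyer operator
`D_n(f)(θ) = (n/π) ∑_{k=1}^n S_{k,n}(θ) ∫_0^π f(t) S_{k,n}(t) dt`. -/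
def grunwaldDurrmeyer (n : ℕ) (f : ℝ → ℝ) (θ : ℝ) : ℝ :=
  n / Real.pi * ∑ k ∈ Finset.Icc 1 n,
    grunwaldFun n k θ * ∫ t in (0 : ℝ)..Real.pi, f t * grunwaldFun n k t

/-- The weighted first moment
`δ_n(θ) = (n/π) ∑_{k=1}^n |S_{k,n}(θ)| ∫_0^π |t - θ_k^{(n)}| |S_{k,n}(t)| dt`. -/
def firstMoment (n : ℕ) (θ : ℝ) : ℝ :=
  n / Real.pi * ∑ k ∈ Finset.Icc 1 n,
    |grunwaldFun n k θ| *
      ∫ t in (0 : ℝ)..Real.pi, |t - chebAngle n k| * |grunwaldFun n k t|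

/-- The modulus of continuity `ω(g, δ) = sup {|g s - g t| : s, t ∈ I, |s - t| ≤ δ}` of a
function `g` on the set `I` (in use, `g` is continuous on a compact interval `I`, so the set
is bounded, and `δ ≥ 0`, so it is nonempty). -/
def modulusOfContinuity (I : Set ℝ) (g : ℝ → ℝ) (δ : ℝ) : ℝ :=
  sSup {r : ℝ | ∃ s ∈ I, ∃ t ∈ I, |s - t| ≤ δ ∧ r = |g s - g t|}

end

/-!
Write `h = π / (2n)` and compare `D_n f` with the Grünwald operator
`G_n f (θ) = ∑ k, f (θ_k) S_{k,n}(θ)`.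

The Christoffel–Darboux identity expands `S_{k,n}` in cosines (`grunwaldFun_eq_sum`). The expansion
gives `∑ k, S_{k,n} = 1` and `∫ S_{k,n} = π / n`, and it shows that the product
`S_{k,n}(t) (cos h - cos (θ_k - t)) (cos h - cos (θ_k + t))` equals
`(-1)^k sin θ_k sin (n t) sin t sin h / n` (`grunwaldFun_mul`). Since the second factor is the first
one plus `2 sin θ_k sin t`, and the first one is comparable to `(θ_k - t)²` away from the two nearest
nodes, `|S_{k,n}(t)|` is at most a multiple of the Cauchy weight `h² / (h² + (t - θ_k)²)`
(`abs_grunwaldFun_le`). The sum of this weight over the nodes is bounded, its integral is of order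
`h`, and its first absolute moment of order `h² log (1 / h)`. The bound for `δ_n` follows
(`firstMoment_le`), and so does `|D_n f - G_n f| ≤ C ω(f, δ_n)`, because
`|f t - f (θ_k)| ≤ (1 + |t - θ_k| / δ) ω(f, δ)`.

For `G_n f - f` the decay `y⁻²` of the kernel would lose a logarithm, so the signs matter. To the
right of `θ` the values `S_{k,n}(θ)` alternate and decrease in absolute value
(`sin_div_antitone`), so summation by parts replaces `f (θ_k) - f θ` by the differences
`f (θ_{k+1}) - f (θ_k)` (`abs_sum_alternating_mul_le`). With `Δ = max (sin θ / n) (1 / n²)`, the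
growth of `|cos θ_{k+1} - cos θ_k| / Δ` away from `θ` is absorbed by a sharper form of the decay
(`abs_grunwaldFun_mul_sin_le`), and what is left is again a bounded sum of Cauchy weights. The nodes
to the left of `θ` are treated by the reflection `θ ↦ π - θ`.
-/

/-! ### Cosine expansions and the closed form of the kernel functions -/

/-- Half the distance of neighbouring Chebyshev angles, `π / (2n)`. -/
noncomputable def halfStep (n : ℕ) : ℝ := Real.pi / (2 * n)

lemma halfStep_pos {n : ℕ} (hn : 1 ≤ n) : 0 < halfStep n := by
  have : (0 : ℝ) < n := by exact_mod_cast hn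
  unfold halfStep
  positivity

lemma nat_mul_halfStep {n : ℕ} (hn : 1 ≤ n) : (n : ℝ) * halfStep n = Real.pi / 2 := by
  have : (0 : ℝ) < n := by exact_mod_cast hn
  unfold halfStep
  field_simp

lemma halfStep_le {n : ℕ} (hn : 1 ≤ n) : halfStep n ≤ Real.pi / 2 := by
  have h1 : (1 : ℝ) ≤ n := by exact_mod_cast hn
  have := nat_mul_halfStep hn
  nlinarith [halfStep_pos hn]

lemma chebAngle_eq (n k : ℕ) : chebAngle n k = (2 * k - 1) * halfStep n := by
  unfold chebAngle halfStep
  ring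

lemma chebAngle_mem {n k : ℕ} (hk : k ∈ Finset.Icc 1 n) :
    chebAngle n k ∈ Icc 0 Real.pi ∧ 0 < Real.sin (chebAngle n k) := by
  obtain ⟨h1, h2⟩ := Finset.mem_Icc.1 hk
  have hn : 1 ≤ n := h1.trans h2
  have h1' : (1 : ℝ) ≤ k := by exact_mod_cast h1
  have h2' : (k : ℝ) ≤ n := by exact_mod_cast h2
  have hh := halfStep_pos hn
  have hN := nat_mul_halfStep hn
  have l : 0 < chebAngle n k := by rw [chebAngle_eq]; nlinarith
  have r : chebAngle n k < Real.pi := by rw [chebAngle_eq]; nlinarith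
  exact ⟨⟨l.le, r.le⟩, Real.sin_pos_of_pos_of_lt_pi l r⟩

lemma nat_mul_chebAngle {n : ℕ} (hn : 1 ≤ n) (k : ℕ) :
    (n : ℝ) * chebAngle n k = k * Real.pi - Real.pi / 2 := by
  rw [chebAngle_eq]
  linear_combination (2 * (k : ℝ) - 1) * nat_mul_halfStep hn

lemma cos_nat_mul_chebAngle {n : ℕ} (hn : 1 ≤ n) (k : ℕ) :
    Real.cos (n * chebAngle n k) = 0 := by
  rw [nat_mul_chebAngle hn, Real.cos_sub_pi_div_two, Real.sin_nat_mul_pi]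

lemma sin_nat_mul_chebAngle {n : ℕ} (hn : 1 ≤ n) (k : ℕ) :
    Real.sin (n * chebAngle n k) = (-1) ^ (k + 1) := by
  rw [nat_mul_chebAngle hn, Real.sin_sub_pi_div_two, Real.cos_nat_mul_pi]
  ring

/-- The Christoffel–Darboux identity for the Chebyshev polynomials, in trigonometric form. -/
lemma christoffelDarboux_cos (n : ℕ) (t φ : ℝ) :
    (Real.cos t - Real.cos φ) *
        (2 * ∑ j ∈ Finset.range n, Real.cos (j * φ) * Real.cos (j * t) - 1) =
      Real.cos (n * t) *
          (Real.cos (n * φ) * Real.cos φ + Real.sin (n * φ) * Real.sin φ) -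
        Real.cos (n * φ) * (Real.cos (n * t) * Real.cos t + Real.sin (n * t) * Real.sin t) := by
  induction n with
  | zero => simp
  | succ n ih =>
    have e (x : ℝ) : ((n + 1 : ℕ) : ℝ) * x = n * x + x := by push_cast; ring
    rw [Finset.sum_range_succ, e, e, Real.cos_add, Real.sin_add, Real.cos_add, Real.sin_add]
    linear_combination ih
      + (Real.cos (n * t) * Real.cos t - Real.sin (n * t) * Real.sin t) * Real.cos (n * φ)
        * (Real.sin_sq_add_cos_sq φ) * (-1)
      + (Real.cos (n * φ) * Real.cos φ - Real.sin (n * φ) * Real.sin φ) * Real.cos (n * t)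
        * (Real.sin_sq_add_cos_sq t)

lemma sum_cos_mul_two_chebAngle {n k : ℕ} (hk : k ∈ Finset.Icc 1 n) :
    ∑ j ∈ Finset.range n, Real.cos (j * (2 * chebAngle n k)) = 1 := by
  have hn : 1 ≤ n := (Finset.mem_Icc.1 hk).1.trans (Finset.mem_Icc.1 hk).2
  set φ := chebAngle n k with hφ
  -- multiplication by `2 sin φ` makes the sum telescope
  have key (m : ℕ) : 2 * Real.sin φ * ∑ j ∈ Finset.range m, Real.cos (j * (2 * φ)) =
      Real.sin (2 * (m * φ) - φ) + Real.sin φ := by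
    induction m with
    | zero => simp
    | succ m ih =>
      have e : 2 * (((m + 1 : ℕ) : ℝ) * φ) - φ = m * (2 * φ) + φ := by push_cast; ring
      have e' : 2 * ((m : ℝ) * φ) - φ = m * (2 * φ) - φ := by ring
      rw [Finset.sum_range_succ, mul_add, ih, e, e', Real.sin_add, Real.sin_sub]
      ring
  have h := key n
  have hs : Real.sin φ ≠ 0 := (chebAngle_mem hk).2.ne'
  rw [Real.sin_sub, Real.sin_two_mul, Real.cos_two_mul, cos_nat_mul_chebAngle hn] at h
  apply mul_left_cancel₀ (mul_ne_zero two_ne_zero hs)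
  rw [h]
  ring

lemma cos_nat_mul_congr {s t : ℝ} (h : Real.cos s = Real.cos t) (j : ℕ) :
    Real.cos (j * s) = Real.cos (j * t) := by
  have h1 := Polynomial.Chebyshev.T_real_cos s (j : ℤ)
  have h2 := Polynomial.Chebyshev.T_real_cos t (j : ℤ)
  push_cast at h1 h2
  rw [← h1, ← h2, h]

/-- The Chebyshev expansion of the fundamental Lagrange functions. -/
lemma lagrangeFun_eq_sum {n k : ℕ} (hk : k ∈ Finset.Icc 1 n) (t : ℝ) :
    lagrangeFun n k t =
      1 / n * (2 * ∑ j ∈ Finset.range n,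
        Real.cos (j * chebAngle n k) * Real.cos (j * t) - 1) := by
  have hn : 1 ≤ n := (Finset.mem_Icc.1 hk).1.trans (Finset.mem_Icc.1 hk).2
  have hn' : (n : ℝ) ≠ 0 := by positivity
  unfold lagrangeFun
  split_ifs with h
  -- at a removable singularity the expansion has to reproduce the prescribed value `1`
  · have e (j : ℕ) : Real.cos (j * chebAngle n k) * Real.cos (j * t) =
        (1 + Real.cos (j * (2 * chebAngle n k))) / 2 := by
      rw [cos_nat_mul_congr h j, mul_left_comm, Real.cos_two_mul]
      ring
    simp_rw [e]
    rw [← Finset.sum_div, Finset.sum_add_distrib, sum_cos_mul_two_chebAngle hk]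
    simp only [Finset.sum_const, Finset.card_range, nsmul_eq_mul]
    field_simp
    ring
  · have hd : Real.cos t - Real.cos (chebAngle n k) ≠ 0 := sub_ne_zero.2 h
    have := christoffelDarboux_cos n t (chebAngle n k)
    rw [cos_nat_mul_chebAngle hn, sin_nat_mul_chebAngle hn] at this
    rw [div_eq_iff (mul_ne_zero hn' hd)]
    generalize ∑ j ∈ Finset.range n, Real.cos (j * chebAngle n k) * Real.cos (j * t) = X at *
    field_simp
    linear_combination -this

/-- The Chebyshev expansion of `S_{k,n}`: averaging over the shifts by `±π/(2n)` multiplies the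
`j`-th coefficient by `cos (jπ/(2n))`. -/
lemma grunwaldFun_eq_sum {n k : ℕ} (hk : k ∈ Finset.Icc 1 n) (t : ℝ) :
    grunwaldFun n k t =
      1 / n * (2 * ∑ j ∈ Finset.range n,
        Real.cos (j * chebAngle n k) * Real.cos (j * halfStep n) * Real.cos (j * t) - 1) := by
  unfold grunwaldFun
  rw [lagrangeFun_eq_sum hk, lagrangeFun_eq_sum hk]
  have e : ∑ j ∈ Finset.range n,
        Real.cos (j * chebAngle n k) * Real.cos (j * halfStep n) * Real.cos (j * t) =
      1 / 2 * (∑ j ∈ Finset.range n,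
          Real.cos (j * chebAngle n k) * Real.cos (j * (t - Real.pi / (2 * n))) +
        ∑ j ∈ Finset.range n,
          Real.cos (j * chebAngle n k) * Real.cos (j * (t + Real.pi / (2 * n)))) := by
    rw [← Finset.sum_add_distrib, Finset.mul_sum]
    refine Finset.sum_congr rfl fun j _ => ?_
    rw [mul_sub (j : ℝ), mul_add (j : ℝ), Real.cos_sub, Real.cos_add]
    unfold halfStep
    ring
  rw [e]
  ring

lemma continuous_grunwaldFun {n k : ℕ} (hk : k ∈ Finset.Icc 1 n) :
    Continuous (grunwaldFun n k) := by
  rw [funext (grunwaldFun_eq_sum hk)]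
  fun_prop

lemma abs_grunwaldFun_le_three {n k : ℕ} (hk : k ∈ Finset.Icc 1 n) (t : ℝ) :
    |grunwaldFun n k t| ≤ 3 := by
  have hn : (1 : ℝ) ≤ n := by
    exact_mod_cast (Finset.mem_Icc.1 hk).1.trans (Finset.mem_Icc.1 hk).2
  have hs : |∑ j ∈ Finset.range n,
      Real.cos (j * chebAngle n k) * Real.cos (j * halfStep n) * Real.cos (j * t)| ≤ n := by
    refine (Finset.abs_sum_le_sum_abs _ _).trans ?_
    refine (Finset.sum_le_sum (g := fun _ => (1 : ℝ)) fun j _ => ?_).trans (by simp)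
    rw [abs_mul, abs_mul]
    exact mul_le_one₀ (mul_le_one₀ (Real.abs_cos_le_one _) (abs_nonneg _)
      (Real.abs_cos_le_one _)) (abs_nonneg _) (Real.abs_cos_le_one _)
  rw [grunwaldFun_eq_sum hk, abs_mul, abs_of_pos (by positivity), one_div, inv_mul_le_iff₀
    (by positivity)]
  rw [abs_le] at hs ⊢
  constructor <;> linarith

lemma sum_cos_nat_mul_chebAngle {n j : ℕ} (hn : 1 ≤ n) (hj : j ∈ Finset.range n) :
    ∑ k ∈ Finset.Icc 1 n, Real.cos (j * chebAngle n k) = if j = 0 then (n : ℝ) else 0 := by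
  split_ifs with h0
  · simp [h0]
  have hj1 : (1 : ℝ) ≤ j := by exact_mod_cast Nat.one_le_iff_ne_zero.2 h0
  have hjn : (j : ℝ) < n := by exact_mod_cast Finset.mem_range.1 hj
  have hh := halfStep_pos hn
  have hN := nat_mul_halfStep hn
  have hs : Real.sin (j * halfStep n) ≠ 0 := by
    refine (Real.sin_pos_of_pos_of_lt_pi (by positivity) ?_).ne'
    nlinarith [Real.pi_pos]
  -- multiplication by `2 sin (j h)` makes the sum telescope
  have key (m : ℕ) : 2 * Real.sin (j * halfStep n) *
      ∑ k ∈ Finset.Icc 1 m, Real.cos (j * chebAngle n k) =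
        Real.sin (m * (2 * (j * halfStep n))) := by
    induction m with
    | zero => simp
    | succ m ih =>
      have e : (j : ℝ) * chebAngle n (m + 1) = m * (2 * (j * halfStep n)) + j * halfStep n := by
        rw [chebAngle_eq]; push_cast; ring
      have e' : ((m + 1 : ℕ) : ℝ) * (2 * (j * halfStep n)) =
          m * (2 * (j * halfStep n)) + 2 * (j * halfStep n) := by push_cast; ring
      rw [Finset.sum_Icc_succ_top (by omega), mul_add, ih, e, e', Real.cos_add, Real.sin_add,
        Real.sin_two_mul, Real.cos_two_mul]
      linear_combination 2 * Real.sin (m * (2 * (j * halfStep n))) *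
        (-(Real.sin_sq_add_cos_sq (j * halfStep n)))
  have h := key n
  rw [show (n : ℝ) * (2 * (j * halfStep n)) = j * Real.pi by linear_combination 2 * (j : ℝ) * hN,
    Real.sin_nat_mul_pi] at h
  exact (mul_eq_zero.1 h).resolve_left (mul_ne_zero two_ne_zero hs)

/-- The functions `S_{k,n}` form a (signed) partition of unity. -/
lemma sum_grunwaldFun {n : ℕ} (hn : 1 ≤ n) (t : ℝ) :
    ∑ k ∈ Finset.Icc 1 n, grunwaldFun n k t = 1 := by
  have hn' : (n : ℝ) ≠ 0 := by positivity
  rw [Finset.sum_congr rfl fun k hk => grunwaldFun_eq_sum hk t, ← Finset.mul_sum,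
    Finset.sum_sub_distrib, ← Finset.mul_sum, Finset.sum_comm]
  have e : ∑ j ∈ Finset.range n, ∑ k ∈ Finset.Icc 1 n,
      Real.cos (j * chebAngle n k) * Real.cos (j * halfStep n) * Real.cos (j * t) = n := by
    have : ∀ j ∈ Finset.range n, ∑ k ∈ Finset.Icc 1 n,
        Real.cos (j * chebAngle n k) * Real.cos (j * halfStep n) * Real.cos (j * t) =
          if j = 0 then (n : ℝ) else 0 := by
      intro j hj
      rw [← Finset.sum_mul, ← Finset.sum_mul, sum_cos_nat_mul_chebAngle hn hj]
      split_ifs with h0 <;> simp [h0]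
    rw [Finset.sum_congr rfl this, Finset.sum_ite_eq', if_pos (Finset.mem_range.2 hn)]
  rw [e]
  simp only [Finset.sum_const, Nat.card_Icc, nsmul_eq_mul, add_tsub_cancel_right]
  field_simp
  ring

lemma integral_cos_nat_mul (j : ℕ) :
    ∫ t in (0 : ℝ)..Real.pi, Real.cos (j * t) = if j = 0 then Real.pi else 0 := by
  split_ifs with h0
  · simp [h0]
  · have : (j : ℝ) ≠ 0 := by exact_mod_cast h0
    rw [intervalIntegral.integral_comp_mul_left _ this]
    simp

lemma integral_grunwaldFun {n k : ℕ} (hk : k ∈ Finset.Icc 1 n) :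
    ∫ t in (0 : ℝ)..Real.pi, grunwaldFun n k t = Real.pi / n := by
  have hn : 1 ≤ n := (Finset.mem_Icc.1 hk).1.trans (Finset.mem_Icc.1 hk).2
  simp_rw [grunwaldFun_eq_sum hk]
  rw [intervalIntegral.integral_const_mul, intervalIntegral.integral_sub,
    intervalIntegral.integral_const_mul, intervalIntegral.integral_finsetSum]
  · simp_rw [intervalIntegral.integral_const_mul, integral_cos_nat_mul]
    have (j : ℕ) : Real.cos (j * chebAngle n k) * Real.cos (j * halfStep n) *
        (if j = 0 then Real.pi else 0) = if j = 0 then Real.pi else 0 := by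
      split_ifs with h0 <;> simp [h0]
    simp_rw [this]
    rw [Finset.sum_ite_eq', if_pos (Finset.mem_range.2 hn)]
    simp
    ring
  · intro j _
    exact (by fun_prop : Continuous _).intervalIntegrable _ _
  · exact (by fun_prop : Continuous _).intervalIntegrable _ _
  · exact (by fun_prop : Continuous _).intervalIntegrable _ _

lemma chebAngle_reflect {n k : ℕ} (hk : k ∈ Finset.Icc 1 n) :
    chebAngle n (n + 1 - k) = Real.pi - chebAngle n k := by
  obtain ⟨h1, h2⟩ := Finset.mem_Icc.1 hk
  have hN := nat_mul_halfStep (h1.trans h2)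
  rw [chebAngle_eq, chebAngle_eq, Nat.cast_sub (by omega)]
  push_cast
  linear_combination 2 * hN

lemma reflect_mem {n k : ℕ} (hk : k ∈ Finset.Icc 1 n) : n + 1 - k ∈ Finset.Icc 1 n := by
  rw [Finset.mem_Icc] at hk ⊢
  omega

lemma cos_nat_mul_pi_sub (j : ℕ) (x : ℝ) :
    Real.cos (j * (Real.pi - x)) = (-1) ^ j * Real.cos (j * x) := by
  rw [mul_sub, Real.cos_sub, Real.cos_nat_mul_pi, Real.sin_nat_mul_pi]
  ring

lemma grunwaldFun_reflect {n k : ℕ} (hk : k ∈ Finset.Icc 1 n) (t : ℝ) :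
    grunwaldFun n (n + 1 - k) (Real.pi - t) = grunwaldFun n k t := by
  rw [grunwaldFun_eq_sum hk, grunwaldFun_eq_sum (reflect_mem hk), chebAngle_reflect hk]
  simp_rw [cos_nat_mul_pi_sub]
  congr 3
  refine Finset.sum_congr rfl fun j _ => ?_
  have : ((-1 : ℝ) ^ j) * (-1) ^ j = 1 := by rw [← mul_pow]; simp
  linear_combination (Real.cos (j * chebAngle n k) * Real.cos (j * halfStep n) *
    Real.cos (j * t)) * this

lemma lagrangeFun_mul {n k : ℕ} (hk : k ∈ Finset.Icc 1 n) (t : ℝ) :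
    n * lagrangeFun n k t * (Real.cos t - Real.cos (chebAngle n k)) =
      (-1) ^ (k + 1) * (Real.cos (n * t) * Real.sin (chebAngle n k)) := by
  have hn : 1 ≤ n := (Finset.mem_Icc.1 hk).1.trans (Finset.mem_Icc.1 hk).2
  have hn' : (n : ℝ) ≠ 0 := by positivity
  have := christoffelDarboux_cos n t (chebAngle n k)
  rw [cos_nat_mul_chebAngle hn, sin_nat_mul_chebAngle hn] at this
  rw [lagrangeFun_eq_sum hk]
  generalize ∑ j ∈ Finset.range n, Real.cos (j * chebAngle n k) * Real.cos (j * t) = X at *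
  field_simp
  linear_combination this

/-- The closed form of `S_{k,n}`, cleared of denominators so that it also holds at the removable
singularities. -/
lemma grunwaldFun_mul {n k : ℕ} (hk : k ∈ Finset.Icc 1 n) (t : ℝ) :
    grunwaldFun n k t *
        ((Real.cos (halfStep n) - Real.cos (chebAngle n k - t)) *
          (Real.cos (halfStep n) - Real.cos (chebAngle n k + t))) =
      (-1) ^ k * Real.sin (chebAngle n k) *
        (Real.sin (n * t) * Real.sin t * Real.sin (halfStep n) / n) := by
  have hn : 1 ≤ n := (Finset.mem_Icc.1 hk).1.trans (Finset.mem_Icc.1 hk).2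
  have hn' : (n : ℝ) ≠ 0 := by positivity
  have h1 := lagrangeFun_mul hk (t - halfStep n)
  have h2 := lagrangeFun_mul hk (t + halfStep n)
  have hS : grunwaldFun n k t =
    1 / 2 * (lagrangeFun n k (t - halfStep n) + lagrangeFun n k (t + halfStep n)) := rfl
  rw [mul_sub (n : ℝ) t, nat_mul_halfStep hn, Real.cos_sub_pi_div_two, Real.cos_sub] at h1
  rw [mul_add (n : ℝ) t, nat_mul_halfStep hn, Real.cos_add_pi_div_two, Real.cos_add] at h2
  rw [hS, Real.cos_sub, Real.cos_add]
  generalize lagrangeFun n k (t - halfStep n) = A at *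
  generalize lagrangeFun n k (t + halfStep n) = B at *
  have p1 := Real.sin_sq_add_cos_sq t
  have p2 := Real.sin_sq_add_cos_sq (chebAngle n k)
  have p3 := Real.sin_sq_add_cos_sq (halfStep n)
  generalize Real.cos t = ct at *
  generalize Real.sin t = st at *
  generalize Real.cos (halfStep n) = ch at *
  generalize Real.sin (halfStep n) = sh at *
  generalize Real.cos (chebAngle n k) = cf at *
  generalize Real.sin (chebAngle n k) = sf at *
  generalize Real.sin (n * t) = sn at *
  have e : (ch - (cf * ct + sf * st)) * (ch - (cf * ct - sf * st)) =
      (ct * ch + st * sh - cf) * (ct * ch - st * sh - cf) := by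
    linear_combination (1 - ch ^ 2 - sf ^ 2) * p1 + (-1 + ct ^ 2) * p2 + st ^ 2 * p3
  rw [e, eq_comm, mul_div_assoc', div_eq_iff hn']
  rw [pow_succ] at h1 h2
  linear_combination (-1/2) * (ct * ch - st * sh - cf) * h1 - (1/2) * (ct * ch + st * sh - cf) * h2

/-! ### Decay of the kernel functions -/

/-- The Cauchy weight `h² / (h² + y²)`, the majorant of the `S_{k,n}`. -/
noncomputable def cauchyWeight (h y : ℝ) : ℝ := 1 / (1 + (y / h) ^ 2)

lemma cauchyWeight_pos (h y : ℝ) : 0 < cauchyWeight h y := by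
  unfold cauchyWeight
  positivity

lemma continuous_cauchyWeight (h φ : ℝ) : Continuous fun t => cauchyWeight h (t - φ) := by
  unfold cauchyWeight
  refine Continuous.div (by fun_prop) (by fun_prop) fun t => by positivity

lemma one_le_mul_cauchyWeight {h y : ℝ} (hh : 0 < h) (hy : |y| ≤ 2 * h) :
    1 ≤ 5 * cauchyWeight h y := by
  have h1 : |y / h| ≤ 2 := by rwa [abs_div, abs_of_pos hh, div_le_iff₀ hh]
  have h2 : (y / h) ^ 2 ≤ 4 := by nlinarith [sq_abs (y / h), abs_nonneg (y / h)]
  unfold cauchyWeight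
  rw [mul_one_div, le_div_iff₀ (by positivity)]
  linarith

lemma div_sq_le_mul_cauchyWeight {h y : ℝ} (hh : 0 < h) (hy : 2 * h ≤ |y|) :
    h ^ 2 / y ^ 2 ≤ 5 / 4 * cauchyWeight h y := by
  have hy0 : 0 < |y| := by linarith
  have h2 : 4 * h ^ 2 ≤ y ^ 2 := by nlinarith [sq_abs y]
  have hy2 : 0 < y ^ 2 := by nlinarith [sq_abs y]
  unfold cauchyWeight
  rw [mul_one_div, div_le_div_iff₀ hy2 (by positivity), div_pow, mul_add, mul_one,
    mul_div_cancel₀ _ (by positivity)]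
  linarith

/-- Away from the two nearest nodes, `cos h - cos y` is comparable to `y²`. -/
lemma sq_le_mul_cos_sub_cos {h y : ℝ} (hh : 0 < h) (hy : 2 * h ≤ |y|) (hy' : |y| ≤ Real.pi) :
    y ^ 2 ≤ 20 * (Real.cos h - Real.cos y) := by
  have h1 := Real.cos_le_one_sub_mul_cos_sq hy'
  have h2 := Real.one_sub_sq_div_two_le_cos (x := h)
  have h3 : 4 * h ^ 2 ≤ y ^ 2 := by nlinarith [sq_abs y]
  have h4 : (1 : ℝ) / 5 ≤ 2 / Real.pi ^ 2 := by
    rw [div_le_div_iff₀ (by norm_num) (by positivity)]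
    nlinarith [Real.pi_lt_d2, Real.pi_pos]
  nlinarith [mul_le_mul_of_nonneg_right h4 (sq_nonneg y)]

lemma sin_mul_sin_nonneg {φ t : ℝ} (hφ : φ ∈ Icc 0 Real.pi) (ht : t ∈ Icc 0 Real.pi) :
    0 ≤ Real.sin φ * Real.sin t :=
  mul_nonneg (Real.sin_nonneg_of_mem_Icc hφ) (Real.sin_nonneg_of_mem_Icc ht)

lemma cos_add_eq_cos_sub_sub (φ t : ℝ) :
    Real.cos (φ + t) = Real.cos (φ - t) - 2 * (Real.sin φ * Real.sin t) := by
  rw [Real.cos_add, Real.cos_sub]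
  ring

lemma inv_eq_mul_halfStep {n : ℕ} (hn : 1 ≤ n) : 1 / (n : ℝ) = 2 * halfStep n / Real.pi := by
  have hn' : (n : ℝ) ≠ 0 := by positivity
  unfold halfStep
  field_simp

lemma abs_sub_le_pi {φ t : ℝ} (hφ : φ ∈ Icc 0 Real.pi) (ht : t ∈ Icc 0 Real.pi) :
    |φ - t| ≤ Real.pi := by
  rw [abs_le]
  constructor <;> linarith [hφ.1, hφ.2, ht.1, ht.2]

/-- The basic estimate `|S_{k,n}(t)| · (cos h - cos (θ_k + t)) · (t - θ_k)² ≤ C sin θ_k sin t · h²`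
away from the nodes nearest to `t`. -/
lemma abs_grunwaldFun_mul_le {n k : ℕ} (hk : k ∈ Finset.Icc 1 n) {t : ℝ}
    (ht : t ∈ Icc 0 Real.pi) (hy : 2 * halfStep n ≤ |chebAngle n k - t|) :
    |grunwaldFun n k t| * (Real.cos (halfStep n) - Real.cos (chebAngle n k + t)) *
        (chebAngle n k - t) ^ 2 ≤
      20 * halfStep n ^ 2 * (Real.sin (chebAngle n k) * Real.sin t) := by
  have hn : 1 ≤ n := (Finset.mem_Icc.1 hk).1.trans (Finset.mem_Icc.1 hk).2
  have hh := halfStep_pos hn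
  have hφ := (chebAngle_mem hk).1
  have hu := sq_le_mul_cos_sub_cos hh hy (abs_sub_le_pi hφ ht)
  have hst := sin_mul_sin_nonneg hφ ht
  have hv := cos_add_eq_cos_sub_sub (chebAngle n k) t
  have hv0 : 0 ≤ Real.cos (halfStep n) - Real.cos (chebAngle n k + t) := by
    nlinarith [sq_nonneg (chebAngle n k - t)]
  have hu0 : 0 ≤ Real.cos (halfStep n) - Real.cos (chebAngle n k - t) := by
    nlinarith [sq_nonneg (chebAngle n k - t)]
  have key := congrArg abs (grunwaldFun_mul hk t)
  have hs0 : 0 ≤ Real.sin (halfStep n) :=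
    Real.sin_nonneg_of_nonneg_of_le_pi hh.le (by linarith [halfStep_le hn, Real.pi_pos])
  have hs1 : Real.sin (halfStep n) ≤ halfStep n := Real.sin_le hh.le
  rw [abs_mul, abs_of_nonneg (mul_nonneg hu0 hv0)] at key
  have hR : |(-1) ^ k * Real.sin (chebAngle n k) *
      (Real.sin (n * t) * Real.sin t * Real.sin (halfStep n) / n)| ≤
        Real.sin (chebAngle n k) * Real.sin t * halfStep n ^ 2 := by
    have e : (-1) ^ k * Real.sin (chebAngle n k) *
      (Real.sin (n * t) * Real.sin t * Real.sin (halfStep n) / n) =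
        (-1) ^ k * Real.sin (n * t) * (Real.sin (chebAngle n k) * Real.sin t) *
          (Real.sin (halfStep n) * (1 / n)) := by ring
    have hN : 1 / (n : ℝ) ≤ halfStep n := by
      rw [inv_eq_mul_halfStep hn, div_le_iff₀ Real.pi_pos]
      nlinarith [Real.pi_gt_three]
    rw [e, abs_mul, abs_mul, abs_mul, abs_pow, abs_neg, abs_one, one_pow, one_mul,
      abs_of_nonneg hst, abs_of_nonneg (by positivity : 0 ≤ Real.sin (halfStep n) * (1 / n))]
    calc _ ≤ 1 * (Real.sin (chebAngle n k) * Real.sin t) * (halfStep n * halfStep n) := by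
          gcongr
          exact Real.abs_sin_le_one _
      _ = _ := by ring
  calc _ ≤ |grunwaldFun n k t| * (Real.cos (halfStep n) - Real.cos (chebAngle n k + t)) *
        (20 * (Real.cos (halfStep n) - Real.cos (chebAngle n k - t))) := by gcongr
    _ = 20 * (|grunwaldFun n k t| * ((Real.cos (halfStep n) - Real.cos (chebAngle n k - t)) *
        (Real.cos (halfStep n) - Real.cos (chebAngle n k + t)))) := by ring
    _ ≤ 20 * (Real.sin (chebAngle n k) * Real.sin t * halfStep n ^ 2) := by
        rw [key]; gcongr
    _ = _ := by ring

/-- The localization `|S_{k,n}(t)| ≤ C h² / (h² + (t - θ_k)²)`. -/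
lemma abs_grunwaldFun_le {n k : ℕ} (hk : k ∈ Finset.Icc 1 n) {t : ℝ}
    (ht : t ∈ Icc 0 Real.pi) :
    |grunwaldFun n k t| ≤ 15 * cauchyWeight (halfStep n) (chebAngle n k - t) := by
  have hn : 1 ≤ n := (Finset.mem_Icc.1 hk).1.trans (Finset.mem_Icc.1 hk).2
  have hh := halfStep_pos hn
  have hφ := (chebAngle_mem hk).1
  rcases le_total (|chebAngle n k - t|) (2 * halfStep n) with hy | hy
  · linarith [abs_grunwaldFun_le_three hk t, one_le_mul_cauchyWeight hh hy]
  · have hu := sq_le_mul_cos_sub_cos hh hy (abs_sub_le_pi hφ ht)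
    have hst := sin_mul_sin_nonneg hφ ht
    have hv := cos_add_eq_cos_sub_sub (chebAngle n k) t
    have hy2 : 0 < (chebAngle n k - t) ^ 2 := by nlinarith [sq_abs (chebAngle n k - t)]
    have hv0 : 0 < Real.cos (halfStep n) - Real.cos (chebAngle n k + t) := by nlinarith
    have h1 := abs_grunwaldFun_mul_le hk ht hy
    have h2 : Real.sin (chebAngle n k) * Real.sin t ≤
        1 / 2 * (Real.cos (halfStep n) - Real.cos (chebAngle n k + t)) := by linarith
    have h3 : |grunwaldFun n k t| * (chebAngle n k - t) ^ 2 ≤ 10 * halfStep n ^ 2 := by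
      refine le_of_mul_le_mul_right ?_ hv0
      nlinarith [mul_le_mul_of_nonneg_left h2 (by positivity : 0 ≤ 20 * halfStep n ^ 2)]
    have h4 : |grunwaldFun n k t| ≤ 10 * (halfStep n ^ 2 / (chebAngle n k - t) ^ 2) := by
      rw [mul_div_assoc', le_div_iff₀ hy2]
      exact h3
    linarith [div_sq_le_mul_cauchyWeight hh hy, cauchyWeight_pos (halfStep n) (chebAngle n k - t)]

/-- The decay is sharper near the endpoints: the additional factor `sin θ_k / sin t`, which is large
when `t` is much closer to an endpoint than `θ_k`, does no harm. The bound `D` replaces `sin t`, which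
may vanish. -/
lemma abs_grunwaldFun_mul_sin_le {n k : ℕ} (hk : k ∈ Finset.Icc 1 n) {t D : ℝ}
    (ht : t ∈ Icc 0 Real.pi) (hy : 2 * halfStep n ≤ |chebAngle n k - t|)
    (hD : Real.sin t ≤ D) :
    |grunwaldFun n k t| * Real.sin (chebAngle n k) ≤
      500 * D * cauchyWeight (halfStep n) (chebAngle n k - t) := by
  have hn : 1 ≤ n := (Finset.mem_Icc.1 hk).1.trans (Finset.mem_Icc.1 hk).2
  have hh := halfStep_pos hn
  have hφ := (chebAngle_mem hk).1
  have hs := (chebAngle_mem hk).2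
  have hu := sq_le_mul_cos_sub_cos hh hy (abs_sub_le_pi hφ ht)
  have hst := sin_mul_sin_nonneg hφ ht
  have hD0 : 0 ≤ D := (Real.sin_nonneg_of_mem_Icc ht).trans hD
  have hv := cos_add_eq_cos_sub_sub (chebAngle n k) t
  have hy2 : 0 < (chebAngle n k - t) ^ 2 := by nlinarith [sq_abs (chebAngle n k - t)]
  have hv0 : 0 < Real.cos (halfStep n) - Real.cos (chebAngle n k + t) := by nlinarith
  have h1 := abs_grunwaldFun_mul_le hk ht hy
  -- `sin² φ ≤ 2 sin φ sin t + (φ - t)²`, and both terms are controlled by `cos h - cos (φ + t)`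
  have h2 : Real.sin (chebAngle n k) ^ 2 ≤
      20 * (Real.cos (halfStep n) - Real.cos (chebAngle n k + t)) := by
    have a := abs_le.1 (Real.abs_sin_sub_sin_le (chebAngle n k) t)
    have b : Real.sin (chebAngle n k) ^ 2 ≤
        2 * (Real.sin (chebAngle n k) * Real.sin t) + (chebAngle n k - t) ^ 2 := by
      nlinarith [sq_abs (chebAngle n k - t), abs_nonneg (chebAngle n k - t),
        sq_nonneg (Real.sin (chebAngle n k) - |chebAngle n k - t|)]
    linarith
  have h3 : |grunwaldFun n k t| * Real.sin (chebAngle n k) * (chebAngle n k - t) ^ 2 ≤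
      400 * D * halfStep n ^ 2 := by
    refine le_of_mul_le_mul_right ?_ hv0
    calc _ = Real.sin (chebAngle n k) * (|grunwaldFun n k t| *
          (Real.cos (halfStep n) - Real.cos (chebAngle n k + t)) * (chebAngle n k - t) ^ 2) := by
          ring
      _ ≤ Real.sin (chebAngle n k) *
          (20 * halfStep n ^ 2 * (Real.sin (chebAngle n k) * Real.sin t)) := by gcongr
      _ = 20 * halfStep n ^ 2 * Real.sin t * Real.sin (chebAngle n k) ^ 2 := by ring
      _ ≤ 20 * halfStep n ^ 2 * D *
          (20 * (Real.cos (halfStep n) - Real.cos (chebAngle n k + t))) := by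
          gcongr
      _ = _ := by ring
  have h4 : |grunwaldFun n k t| * Real.sin (chebAngle n k) ≤
      400 * D * (halfStep n ^ 2 / (chebAngle n k - t) ^ 2) := by
    rw [mul_div_assoc', le_div_iff₀ hy2]
    exact h3
  calc _ ≤ 400 * D * (halfStep n ^ 2 / (chebAngle n k - t) ^ 2) := h4
    _ ≤ 400 * D * (5 / 4 * cauchyWeight (halfStep n) (chebAngle n k - t)) := by
        gcongr
        exact div_sq_le_mul_cauchyWeight hh hy
    _ = _ := by ring

/-- On an interval of length `2` around `y`, `1 / (1 + z²)` is at least a third of its value at `y`. -/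
lemma one_div_one_add_sq_le_arctan (y : ℝ) :
    1 / (1 + y ^ 2) ≤ 3 / 2 * (Real.arctan (y + 1) - Real.arctan (y - 1)) := by
  rw [← integral_one_div_one_add_sq]
  have h : ∫ _ in (y - 1)..(y + 1), 1 / 3 * (1 / (1 + y ^ 2)) ≤
      ∫ z in (y - 1)..(y + 1), 1 / (1 + z ^ 2) := by
    refine intervalIntegral.integral_mono_on (by linarith) (by simp) ?_ fun z hz => ?_
    · exact (Continuous.div (by fun_prop) (by fun_prop)
        fun z => by positivity).intervalIntegrable _ _
    · rw [one_div_mul_one_div, div_le_div_iff₀ (by positivity) (by positivity)]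
      nlinarith [mul_nonneg (sub_nonneg.2 hz.1) (sub_nonneg.2 hz.2), sq_nonneg (z - 2 * y),
        sq_nonneg (z + y)]
  rw [intervalIntegral.integral_const, smul_eq_mul] at h
  linarith

/-- The Cauchy weights at the Chebyshev angles have uniformly bounded sums, by comparison with a
telescoping sum of arctangents. -/
lemma sum_cauchyWeight_le {n : ℕ} (hn : 1 ≤ n) (t : ℝ) :
    ∑ k ∈ Finset.Icc 1 n, cauchyWeight (halfStep n) (chebAngle n k - t) ≤ 5 := by
  have hh := halfStep_pos hn
  have key (m : ℕ) : ∑ k ∈ Finset.Icc 1 m, cauchyWeight (halfStep n) (chebAngle n k - t) ≤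
      3 / 2 * (Real.arctan (2 * m - t / halfStep n) - Real.arctan (-(t / halfStep n))) := by
    induction m with
    | zero => simp
    | succ m ih =>
      rw [Finset.sum_Icc_succ_top (by omega)]
      have e : (chebAngle n (m + 1) - t) / halfStep n = 2 * m + 1 - t / halfStep n := by
        rw [chebAngle_eq, sub_div, mul_div_cancel_right₀ _ hh.ne']
        push_cast
        ring
      have := one_div_one_add_sq_le_arctan (2 * m + 1 - t / halfStep n)
      rw [show 2 * (m : ℝ) + 1 - t / halfStep n + 1 = 2 * ((m + 1 : ℕ) : ℝ) - t / halfStep n by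
        push_cast; ring,
        show 2 * (m : ℝ) + 1 - t / halfStep n - 1 = 2 * m - t / halfStep n by ring] at this
      unfold cauchyWeight at ih ⊢
      rw [e]
      linarith
  have := key n
  have a := Real.arctan_lt_pi_div_two (2 * n - t / halfStep n)
  have b := Real.neg_pi_div_two_lt_arctan (-(t / halfStep n))
  linarith [Real.pi_lt_d2]

lemma sum_abs_grunwaldFun_le {n : ℕ} (hn : 1 ≤ n) {t : ℝ} (ht : t ∈ Icc 0 Real.pi) :
    ∑ k ∈ Finset.Icc 1 n, |grunwaldFun n k t| ≤ 75 := by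
  calc _ ≤ ∑ k ∈ Finset.Icc 1 n, 15 * cauchyWeight (halfStep n) (chebAngle n k - t) :=
        Finset.sum_le_sum fun k hk => abs_grunwaldFun_le hk ht
    _ = 15 * ∑ k ∈ Finset.Icc 1 n, cauchyWeight (halfStep n) (chebAngle n k - t) := by
        rw [Finset.mul_sum]
    _ ≤ 75 := by linarith [sum_cauchyWeight_le hn t]

/-! ### The modulus of continuity -/

lemma modulusOfContinuity_nonneg (I : Set ℝ) (g : ℝ → ℝ) (δ : ℝ) :
    0 ≤ modulusOfContinuity I g δ := by
  refine Real.sSup_nonneg ?_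
  rintro r ⟨s, -, t, -, -, rfl⟩
  exact abs_nonneg _

lemma abs_sub_le_modulusOfContinuity {a b : ℝ} {g : ℝ → ℝ} (hg : ContinuousOn g (Icc a b))
    {δ s t : ℝ} (hs : s ∈ Icc a b) (ht : t ∈ Icc a b) (hst : |s - t| ≤ δ) :
    |g s - g t| ≤ modulusOfContinuity (Icc a b) g δ := by
  obtain ⟨M, hM⟩ := isCompact_Icc.exists_bound_of_continuousOn hg
  refine le_csSup ⟨M + M, ?_⟩ ⟨s, hs, t, ht, hst, rfl⟩
  rintro r ⟨x, hx, y, hy, -, rfl⟩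
  exact (abs_sub _ _).trans (add_le_add (hM x hx) (hM y hy))

lemma abs_sub_le_nat_mul_modulusOfContinuity {a b : ℝ} {g : ℝ → ℝ}
    (hg : ContinuousOn g (Icc a b)) {δ : ℝ} (N : ℕ) {s t : ℝ} (hs : s ∈ Icc a b)
    (ht : t ∈ Icc a b) (hst : |s - t| ≤ N * δ) :
    |g s - g t| ≤ N * modulusOfContinuity (Icc a b) g δ := by
  induction N generalizing s with
  | zero =>
    have : s = t := by
      rw [← sub_eq_zero, ← abs_nonpos_iff]
      simpa using hst
    simp [this]
  | succ N ih =>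
    push_cast at hst ⊢
    have hN : (0 : ℝ) < N + 1 := by positivity
    -- the point of the segment from `t` to `s` that lies at the fraction `N / (N + 1)`
    set r := t + N / (N + 1) * (s - t) with hr
    have hsr : s - r = (s - t) / (N + 1) := by rw [hr]; field_simp; ring
    have hrI : r ∈ Icc a b := by
      have := (convex_Icc a b).add_smul_sub_mem ht hs
        (t := (N : ℝ) / (N + 1)) ⟨by positivity, by rw [div_le_one hN]; linarith⟩
      simpa [hr] using this
    have h1 : |s - r| ≤ δ := by
      rw [hsr, abs_div, abs_of_pos hN, div_le_iff₀ hN]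
      linarith
    have h2 : |r - t| ≤ N * δ := by
      have : r - t = N * ((s - t) / (N + 1)) := by rw [hr]; ring
      rw [this, abs_mul, Nat.abs_cast, ← hsr]
      gcongr
    calc |g s - g t| ≤ |g s - g r| + |g r - g t| := abs_sub_le _ _ _
      _ ≤ modulusOfContinuity (Icc a b) g δ + N * modulusOfContinuity (Icc a b) g δ :=
          add_le_add (abs_sub_le_modulusOfContinuity hg hs hrI h1) (ih hrI h2)
      _ = _ := by ring

lemma abs_sub_le_mul_modulusOfContinuity {a b : ℝ} {g : ℝ → ℝ}
    (hg : ContinuousOn g (Icc a b)) {δ : ℝ} (hδ : 0 < δ) {s t : ℝ} (hs : s ∈ Icc a b)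
    (ht : t ∈ Icc a b) :
    |g s - g t| ≤ (1 + |s - t| / δ) * modulusOfContinuity (Icc a b) g δ := by
  have h0 : 0 ≤ |s - t| / δ := by positivity
  refine (abs_sub_le_nat_mul_modulusOfContinuity (δ := δ) hg ⌈|s - t| / δ⌉₊ hs ht ?_).trans ?_
  · rw [← div_le_iff₀ hδ]
    exact Nat.le_ceil _
  · refine mul_le_mul_of_nonneg_right ?_ (modulusOfContinuity_nonneg _ _ _)
    linarith [Nat.ceil_lt_add_one h0]

/-! ### Integrals of the kernel functions -/

lemma integral_cauchyWeight_le {h : ℝ} (hh : 0 < h) (φ a b : ℝ) :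
    ∫ t in a..b, cauchyWeight h (t - φ) ≤ Real.pi * h := by
  have hd (t : ℝ) : HasDerivAt (fun t => h * Real.arctan ((t - φ) / h))
      (cauchyWeight h (t - φ)) t := by
    have := ((((hasDerivAt_id t).sub_const φ).div_const h).arctan).const_mul h
    refine this.congr_deriv ?_
    unfold cauchyWeight
    simp only [id]
    field_simp
  rw [intervalIntegral.integral_eq_sub_of_hasDerivAt (fun t _ => hd t)
    ((continuous_cauchyWeight h φ).intervalIntegrable _ _)]
  have h1 := Real.arctan_lt_pi_div_two ((b - φ) / h)
  have h2 := Real.neg_pi_div_two_lt_arctan ((a - φ) / h)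
  nlinarith

lemma integral_sub_mul_cauchyWeight {h : ℝ} (hh : 0 < h) (φ a b : ℝ) :
    ∫ t in a..b, (t - φ) * cauchyWeight h (t - φ) =
      h ^ 2 / 2 * Real.log (1 + ((b - φ) / h) ^ 2) -
        h ^ 2 / 2 * Real.log (1 + ((a - φ) / h) ^ 2) := by
  have hd (t : ℝ) : HasDerivAt (fun t => h ^ 2 / 2 * Real.log (1 + ((t - φ) / h) ^ 2))
      ((t - φ) * cauchyWeight h (t - φ)) t := by
    have h1 : HasDerivAt (fun t => 1 + ((t - φ) / h) ^ 2) (2 * ((t - φ) / h) * (1 / h)) t := by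
      simpa using ((((hasDerivAt_id t).sub_const φ).div_const h).fun_pow 2).const_add 1
    have h0 : 1 + ((t - φ) / h) ^ 2 ≠ 0 := by positivity
    refine ((h1.log h0).const_mul (h ^ 2 / 2)).congr_deriv ?_
    unfold cauchyWeight
    generalize 1 + ((t - φ) / h) ^ 2 = X at h0
    field_simp
  have hc := continuous_cauchyWeight h φ
  rw [intervalIntegral.integral_eq_sub_of_hasDerivAt (fun t _ => hd t)
    ((by fun_prop : Continuous fun t => (t - φ) * cauchyWeight h (t - φ)).intervalIntegrable _ _)]

/-- The first absolute moment of the Cauchy weight grows logarithmically: `1 / h` is of order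
`n`, and the weight is only of order `y⁻²`. -/
lemma integral_abs_sub_mul_cauchyWeight_le {h φ : ℝ} (hh : 0 < h) (hφ : φ ∈ Icc 0 Real.pi) :
    ∫ t in (0 : ℝ)..Real.pi, |t - φ| * cauchyWeight h (t - φ) ≤
      h ^ 2 * Real.log (1 + (Real.pi / h) ^ 2) := by
  have hc := continuous_cauchyWeight h φ
  have hc' : Continuous fun t => |t - φ| * cauchyWeight h (t - φ) := by fun_prop
  have h1 : ∫ t in (0 : ℝ)..φ, |t - φ| * cauchyWeight h (t - φ) =
      -∫ t in (0 : ℝ)..φ, (t - φ) * cauchyWeight h (t - φ) := by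
    rw [← intervalIntegral.integral_neg]
    refine intervalIntegral.integral_congr fun t ht => ?_
    rw [uIcc_of_le hφ.1] at ht
    rw [abs_of_nonpos (by linarith [ht.2])]
    ring
  have h2 : ∫ t in φ..Real.pi, |t - φ| * cauchyWeight h (t - φ) =
      ∫ t in φ..Real.pi, (t - φ) * cauchyWeight h (t - φ) := by
    refine intervalIntegral.integral_congr fun t ht => ?_
    rw [uIcc_of_le hφ.2] at ht
    rw [abs_of_nonneg (by linarith [ht.1])]
  have hlog {y : ℝ} (hy : |y| ≤ Real.pi) :
      Real.log (1 + (y / h) ^ 2) ≤ Real.log (1 + (Real.pi / h) ^ 2) := by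
    have : y ^ 2 ≤ Real.pi ^ 2 := by
      rw [← sq_abs y]
      gcongr
    refine Real.log_le_log (by positivity) ?_
    rw [div_pow, div_pow]
    gcongr
  have a1 := hlog (y := 0 - φ) (by rw [abs_le]; constructor <;> linarith [hφ.1, hφ.2])
  have a2 := hlog (y := Real.pi - φ) (by rw [abs_le]; constructor <;> linarith [hφ.1, hφ.2])
  rw [← intervalIntegral.integral_add_adjacent_intervals (b := φ)
    (hc'.intervalIntegrable _ _) (hc'.intervalIntegrable _ _), h1, h2,
    integral_sub_mul_cauchyWeight hh, integral_sub_mul_cauchyWeight hh]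
  simp only [sub_self, zero_div, ne_eq, OfNat.ofNat_ne_zero, not_false_eq_true, zero_pow,
    add_zero, Real.log_one, mul_zero]
  have := sq_nonneg h
  nlinarith [mul_le_mul_of_nonneg_left a1 this, mul_le_mul_of_nonneg_left a2 this]

lemma abs_grunwaldFun_le' {n k : ℕ} (hk : k ∈ Finset.Icc 1 n) {t : ℝ}
    (ht : t ∈ Icc 0 Real.pi) :
    |grunwaldFun n k t| ≤ 15 * cauchyWeight (halfStep n) (t - chebAngle n k) := by
  have h := abs_grunwaldFun_le hk ht
  have e : cauchyWeight (halfStep n) (chebAngle n k - t) =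
      cauchyWeight (halfStep n) (t - chebAngle n k) := by
    unfold cauchyWeight
    ring
  rwa [e] at h

lemma integral_abs_grunwaldFun_le {n k : ℕ} (hk : k ∈ Finset.Icc 1 n) :
    ∫ t in (0 : ℝ)..Real.pi, |grunwaldFun n k t| ≤ 15 * (Real.pi * halfStep n) := by
  have hn : 1 ≤ n := (Finset.mem_Icc.1 hk).1.trans (Finset.mem_Icc.1 hk).2
  have hc := continuous_cauchyWeight (halfStep n) (chebAngle n k)
  have hS := continuous_grunwaldFun hk
  calc _ ≤ ∫ t in (0 : ℝ)..Real.pi, 15 * cauchyWeight (halfStep n) (t - chebAngle n k) :=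
        intervalIntegral.integral_mono_on Real.pi_pos.le
          (hS.abs.intervalIntegrable _ _)
          ((by fun_prop : Continuous fun t => 15 * cauchyWeight (halfStep n)
            (t - chebAngle n k)).intervalIntegrable _ _)
          fun t ht => abs_grunwaldFun_le' hk ht
    _ = 15 * ∫ t in (0 : ℝ)..Real.pi, cauchyWeight (halfStep n) (t - chebAngle n k) := by
        rw [intervalIntegral.integral_const_mul]
    _ ≤ _ := by
        gcongr
        exact integral_cauchyWeight_le (halfStep_pos hn) _ _ _

lemma integral_abs_sub_mul_abs_grunwaldFun_le {n k : ℕ} (hk : k ∈ Finset.Icc 1 n) :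
    ∫ t in (0 : ℝ)..Real.pi, |t - chebAngle n k| * |grunwaldFun n k t| ≤
      30 * halfStep n ^ 2 * (1 + Real.log n) := by
  have hn : 1 ≤ n := (Finset.mem_Icc.1 hk).1.trans (Finset.mem_Icc.1 hk).2
  have hn1 : (1 : ℝ) ≤ n := by exact_mod_cast hn
  have hc := continuous_cauchyWeight (halfStep n) (chebAngle n k)
  have hS := continuous_grunwaldFun hk
  have hlog : Real.log (1 + (Real.pi / halfStep n) ^ 2) ≤ 2 * (1 + Real.log n) := by
    have e : Real.pi / halfStep n = 2 * n := by
      unfold halfStep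
      have := Real.pi_pos.ne'
      field_simp
    rw [e]
    calc Real.log (1 + (2 * (n : ℝ)) ^ 2) ≤ Real.log ((Real.exp 1 * n) ^ 2) := by
          refine Real.log_le_log (by positivity) ?_
          nlinarith [mul_self_le_mul_self (by norm_num) Real.exp_one_gt_d9.le]
      _ = 2 * (1 + Real.log n) := by
          rw [Real.log_pow, Real.log_mul (Real.exp_pos 1).ne' (by positivity), Real.log_exp]
          norm_num
  calc _ ≤ ∫ t in (0 : ℝ)..Real.pi,
          15 * (|t - chebAngle n k| * cauchyWeight (halfStep n) (t - chebAngle n k)) := by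
        refine intervalIntegral.integral_mono_on Real.pi_pos.le
          ((by fun_prop : Continuous fun t =>
            |t - chebAngle n k| * |grunwaldFun n k t|).intervalIntegrable _ _)
          ((by fun_prop : Continuous fun t => 15 * (|t - chebAngle n k| *
            cauchyWeight (halfStep n) (t - chebAngle n k))).intervalIntegrable _ _)
          fun t ht => ?_
        calc _ ≤ |t - chebAngle n k| *
              (15 * cauchyWeight (halfStep n) (t - chebAngle n k)) := by
              gcongr
              exact abs_grunwaldFun_le' hk ht
          _ = _ := by ring
    _ = 15 * ∫ t in (0 : ℝ)..Real.pi,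
          |t - chebAngle n k| * cauchyWeight (halfStep n) (t - chebAngle n k) := by
        rw [intervalIntegral.integral_const_mul]
    _ ≤ 15 * (halfStep n ^ 2 * (2 * (1 + Real.log n))) := by
        gcongr
        refine (integral_abs_sub_mul_cauchyWeight_le (halfStep_pos hn)
          (chebAngle_mem hk).1).trans ?_
        gcongr
    _ = _ := by ring

lemma firstMoment_le {n : ℕ} (hn : 1 ≤ n) {θ : ℝ} (hθ : θ ∈ Icc 0 Real.pi) :
    firstMoment n θ ≤ 2250 * ((1 + Real.log n) / n) := by
  have hn1 : (1 : ℝ) ≤ n := by exact_mod_cast hn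
  have hl : 0 ≤ 1 + Real.log n := by linarith [Real.log_nonneg hn1]
  unfold firstMoment
  calc _ ≤ n / Real.pi * ∑ k ∈ Finset.Icc 1 n,
        |grunwaldFun n k θ| * (30 * halfStep n ^ 2 * (1 + Real.log n)) := by
        gcongr with k hk
        exact integral_abs_sub_mul_abs_grunwaldFun_le hk
    _ = n / Real.pi * ((∑ k ∈ Finset.Icc 1 n, |grunwaldFun n k θ|) *
          (30 * halfStep n ^ 2 * (1 + Real.log n))) := by rw [Finset.sum_mul]
    _ ≤ n / Real.pi * (75 * (30 * halfStep n ^ 2 * (1 + Real.log n))) := by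
        gcongr
        exact sum_abs_grunwaldFun_le hn hθ
    _ = Real.pi / 4 * (2250 * ((1 + Real.log n) / n)) := by
        unfold halfStep
        have := Real.pi_pos.ne'
        field_simp
        ring
    _ ≤ 1 * (2250 * ((1 + Real.log n) / n)) := by
        gcongr
        linarith [Real.pi_lt_d2]
    _ = _ := one_mul _

lemma integral_abs_sub_mul_abs_grunwaldFun_pos {n k : ℕ} (hk : k ∈ Finset.Icc 1 n) :
    0 < ∫ t in (0 : ℝ)..Real.pi, |t - chebAngle n k| * |grunwaldFun n k t| := by
  have hn : 1 ≤ n := (Finset.mem_Icc.1 hk).1.trans (Finset.mem_Icc.1 hk).2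
  have hS := continuous_grunwaldFun hk
  refine intervalIntegral.integral_pos Real.pi_pos
    (by fun_prop : Continuous fun t =>
      |t - chebAngle n k| * |grunwaldFun n k t|).continuousOn (fun t _ => by positivity) ?_
  by_contra! hcon
  -- otherwise `S_{k,n}` vanishes almost everywhere, but its integral is `π / n`
  have h0 : ∫ t in (0 : ℝ)..Real.pi, grunwaldFun n k t = ∫ _ in (0 : ℝ)..Real.pi, (0 : ℝ) := by
    refine intervalIntegral.integral_congr_ae ?_
    filter_upwards [MeasureTheory.compl_mem_ae_iff.2
      (MeasureTheory.measure_singleton (μ := MeasureTheory.volume) (chebAngle n k))] with t ht htI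
    rw [uIoc_of_le Real.pi_pos.le] at htI
    have h1 := le_antisymm (hcon t ⟨htI.1.le, htI.2⟩) (by positivity)
    have h2 : t - chebAngle n k ≠ 0 := sub_ne_zero.2 ht
    simpa [h2] using h1
  rw [integral_grunwaldFun hk, intervalIntegral.integral_zero] at h0
  have : 0 < Real.pi / n := by have := Real.pi_pos; positivity
  linarith

/-- Positivity of `δ_n(θ)`, needed to divide by it. -/
lemma firstMoment_pos {n : ℕ} (hn : 1 ≤ n) (θ : ℝ) : 0 < firstMoment n θ := by
  have hn' : (0 : ℝ) < n := by exact_mod_cast hn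
  have hsum := sum_grunwaldFun hn θ
  obtain ⟨k, hk, hk0⟩ := Finset.exists_ne_zero_of_sum_ne_zero
    (show ∑ k ∈ Finset.Icc 1 n, grunwaldFun n k θ ≠ 0 by rw [hsum]; exact one_ne_zero)
  refine mul_pos (div_pos hn' Real.pi_pos) (Finset.sum_pos' (fun j hj => ?_) ⟨k, hk, ?_⟩)
  · exact mul_nonneg (abs_nonneg _) (integral_abs_sub_mul_abs_grunwaldFun_pos hj).le
  · exact mul_pos (abs_pos.2 hk0) (integral_abs_sub_mul_abs_grunwaldFun_pos hk)

/-! ### Comparison with the Grünwald operator -/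

lemma abs_integral_sub_mul_grunwaldFun_le {n k : ℕ} (hk : k ∈ Finset.Icc 1 n) {f : ℝ → ℝ}
    (hf : ContinuousOn f (Icc 0 Real.pi)) {δ : ℝ} (hδ : 0 < δ) :
    |(∫ t in (0 : ℝ)..Real.pi, f t * grunwaldFun n k t) - f (chebAngle n k) * (Real.pi / n)| ≤
      (15 * (Real.pi * halfStep n) + 1 / δ * ∫ t in (0 : ℝ)..Real.pi,
        |t - chebAngle n k| * |grunwaldFun n k t|) *
          modulusOfContinuity (Icc 0 Real.pi) f δ := by
  have hS := continuous_grunwaldFun hk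
  set W := modulusOfContinuity (Icc 0 Real.pi) f δ
  have hW : 0 ≤ W := modulusOfContinuity_nonneg _ _ _
  have hfS : IntervalIntegrable (fun t => f t * grunwaldFun n k t) MeasureTheory.volume
      0 Real.pi := by
    refine ContinuousOn.intervalIntegrable ?_
    rw [uIcc_of_le Real.pi_pos.le]
    exact hf.mul hS.continuousOn
  have i1 : IntervalIntegrable (fun t => f (chebAngle n k) * grunwaldFun n k t)
      MeasureTheory.volume 0 Real.pi := (by fun_prop : Continuous _).intervalIntegrable _ _
  have i2 : IntervalIntegrable (fun t => |grunwaldFun n k t|)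
      MeasureTheory.volume 0 Real.pi := (by fun_prop : Continuous _).intervalIntegrable _ _
  have i3 : IntervalIntegrable (fun t => 1 / δ * (|t - chebAngle n k| * |grunwaldFun n k t|))
      MeasureTheory.volume 0 Real.pi := (by fun_prop : Continuous _).intervalIntegrable _ _
  rw [← integral_grunwaldFun hk, ← intervalIntegral.integral_const_mul,
    ← intervalIntegral.integral_sub hfS i1]
  calc _ ≤ ∫ t in (0 : ℝ)..Real.pi,
        |f t * grunwaldFun n k t - f (chebAngle n k) * grunwaldFun n k t| :=
        intervalIntegral.abs_integral_le_integral_abs Real.pi_pos.le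
    _ ≤ ∫ t in (0 : ℝ)..Real.pi, (|grunwaldFun n k t| +
          1 / δ * (|t - chebAngle n k| * |grunwaldFun n k t|)) * W := by
        refine intervalIntegral.integral_mono_on Real.pi_pos.le (hfS.sub i1).abs
          ((i2.add i3).mul_const _) fun t ht => ?_
        have := abs_sub_le_mul_modulusOfContinuity hf hδ ht (chebAngle_mem hk).1
        rw [← sub_mul, abs_mul]
        calc _ ≤ (1 + |t - chebAngle n k| / δ) * W * |grunwaldFun n k t| := by gcongr
          _ = _ := by ring
    _ = ((∫ t in (0 : ℝ)..Real.pi, |grunwaldFun n k t|) + 1 / δ * ∫ t in (0 : ℝ)..Real.pi,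
        |t - chebAngle n k| * |grunwaldFun n k t|) * W := by
        rw [intervalIntegral.integral_mul_const, intervalIntegral.integral_add i2 i3,
          intervalIntegral.integral_const_mul]
    _ ≤ _ := by
        gcongr
        exact integral_abs_grunwaldFun_le hk

/-- The Grünwald–Durrmeyer operator differs from the Grünwald operator
`∑ k, f (θ_k) S_{k,n}(θ)` by at most a multiple of `ω(f, δ_n(θ))`. -/
lemma abs_grunwaldDurrmeyer_sub_sum_le {n : ℕ} (hn : 1 ≤ n) {f : ℝ → ℝ}
    (hf : ContinuousOn f (Icc 0 Real.pi)) {θ : ℝ} (hθ : θ ∈ Icc 0 Real.pi) :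
    |grunwaldDurrmeyer n f θ -
        ∑ k ∈ Finset.Icc 1 n, grunwaldFun n k θ * f (chebAngle n k)| ≤
      2000 * modulusOfContinuity (Icc 0 Real.pi) f (firstMoment n θ) := by
  have hn' : (n : ℝ) ≠ 0 := by positivity
  have hδ := firstMoment_pos hn θ
  have hh := halfStep_pos hn
  have hpi := Real.pi_pos
  set W := modulusOfContinuity (Icc 0 Real.pi) f (firstMoment n θ) with hWdef
  have hW : 0 ≤ W := modulusOfContinuity_nonneg _ _ _
  set I : ℕ → ℝ := fun k =>
    ∫ t in (0 : ℝ)..Real.pi, |t - chebAngle n k| * |grunwaldFun n k t| with hI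
  have e : grunwaldDurrmeyer n f θ -
      ∑ k ∈ Finset.Icc 1 n, grunwaldFun n k θ * f (chebAngle n k) =
        n / Real.pi * ∑ k ∈ Finset.Icc 1 n, grunwaldFun n k θ *
          ((∫ t in (0 : ℝ)..Real.pi, f t * grunwaldFun n k t) -
            f (chebAngle n k) * (Real.pi / n)) := by
    unfold grunwaldDurrmeyer
    simp_rw [mul_sub]
    rw [Finset.sum_sub_distrib, mul_sub]
    congr 1
    rw [Finset.mul_sum]
    refine Finset.sum_congr rfl fun k _ => ?_
    field_simp
  have hM : n / Real.pi * ∑ k ∈ Finset.Icc 1 n, |grunwaldFun n k θ| * I k =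
      firstMoment n θ := rfl
  rw [e, abs_mul, abs_of_pos (by positivity)]
  calc _ ≤ n / Real.pi * ∑ k ∈ Finset.Icc 1 n, |grunwaldFun n k θ| *
        ((15 * (Real.pi * halfStep n) + 1 / firstMoment n θ * I k) * W) := by
        gcongr
        refine (Finset.abs_sum_le_sum_abs _ _).trans (Finset.sum_le_sum fun k hk => ?_)
        rw [abs_mul]
        gcongr
        exact abs_integral_sub_mul_grunwaldFun_le hk hf hδ
    _ = (15 * (n * halfStep n) * (∑ k ∈ Finset.Icc 1 n, |grunwaldFun n k θ|) +
          1 / firstMoment n θ *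
            (n / Real.pi * ∑ k ∈ Finset.Icc 1 n, |grunwaldFun n k θ| * I k)) * W := by
        have : ∀ k ∈ Finset.Icc 1 n, |grunwaldFun n k θ| *
            ((15 * (Real.pi * halfStep n) + 1 / firstMoment n θ * I k) * W) =
            15 * (Real.pi * halfStep n) * W * |grunwaldFun n k θ| +
              1 / firstMoment n θ * W * (|grunwaldFun n k θ| * I k) := fun k _ => by ring
        rw [Finset.sum_congr rfl this, Finset.sum_add_distrib, ← Finset.mul_sum,
          ← Finset.mul_sum]
        generalize ∑ k ∈ Finset.Icc 1 n, |grunwaldFun n k θ| * I k = X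
        generalize ∑ k ∈ Finset.Icc 1 n, |grunwaldFun n k θ| = Y
        field_simp
    _ ≤ (15 * (Real.pi / 2) * 75 + 1) * W := by
        rw [hM, one_div_mul_cancel hδ.ne', nat_mul_halfStep hn]
        gcongr
        exact sum_abs_grunwaldFun_le hn hθ
    _ ≤ 2000 * W := by
        gcongr
        linarith [Real.pi_lt_d2]

/-! ### Summation by parts -/

lemma abs_sum_alternating_le {b : ℕ → ℝ} {d : ℕ} (h0 : ∀ i ≤ d, 0 ≤ b i)
    (hb : ∀ i < d, b (i + 1) ≤ b i) :
    |∑ i ∈ Finset.range (d + 1), (-1) ^ i * b i| ≤ b 0 := by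
  -- partial sums lie between `0` and the first term
  suffices h : 0 ≤ ∑ i ∈ Finset.range (d + 1), (-1) ^ i * b i ∧
      ∑ i ∈ Finset.range (d + 1), (-1) ^ i * b i ≤ b 0 by
    rw [abs_of_nonneg h.1]
    exact h.2
  induction d generalizing b with
  | zero => simpa using h0 0 le_rfl
  | succ d ih =>
    have := ih (b := fun i => b (i + 1)) (fun i hi => h0 (i + 1) (by omega))
      fun i hi => hb (i + 1) (by omega)
    have e : ∑ i ∈ Finset.range (d + 1 + 1), (-1) ^ i * b i =
        b 0 - ∑ i ∈ Finset.range (d + 1), (-1) ^ i * b (i + 1) := by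
      rw [Finset.sum_range_succ', ← sub_eq_zero]
      simp [pow_succ]
      ring
    have := hb 0 (by omega)
    rw [e]
    constructor <;> linarith

/-- Summation by parts against an alternating sequence with decreasing absolute values: the tails
of such a sequence are bounded by their first terms. -/
lemma abs_sum_alternating_mul_le {b g : ℕ → ℝ} {d : ℕ} (h0 : ∀ i ≤ d, 0 ≤ b i)
    (hb : ∀ i < d, b (i + 1) ≤ b i) :
    |∑ i ∈ Finset.range (d + 1), (-1) ^ i * b i * g i| ≤
      b 0 * |g 0| + ∑ i ∈ Finset.range d, b (i + 1) * |g (i + 1) - g i| := by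
  induction d generalizing b g with
  | zero => simp [abs_mul, abs_of_nonneg (h0 0 le_rfl)]
  | succ d ih =>
    have h1 := ih (b := fun i => b (i + 1)) (g := fun i => g (i + 1) - g 0)
      (fun i hi => h0 (i + 1) (by omega)) fun i hi => hb (i + 1) (by omega)
    have h2 := abs_sum_alternating_le h0 hb
    have e : ∑ i ∈ Finset.range (d + 1 + 1), (-1) ^ i * b i * g i =
        g 0 * ∑ i ∈ Finset.range (d + 1 + 1), (-1) ^ i * b i -
          ∑ i ∈ Finset.range (d + 1), (-1) ^ i * b (i + 1) * (g (i + 1) - g 0) := by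
      rw [Finset.sum_range_succ', Finset.sum_range_succ' (fun i => (-1) ^ i * b i),
        mul_add, Finset.mul_sum, add_sub_right_comm, ← Finset.sum_sub_distrib]
      congr 1
      · refine Finset.sum_congr rfl fun i _ => ?_
        rw [pow_succ]
        ring
      · ring
    rw [e, Finset.sum_range_succ' (fun i => b (i + 1) * |g (i + 1) - g i|)]
    calc _ ≤ _ := abs_sub _ _
      _ ≤ |g 0| * b 0 + (b (0 + 1) * |g (0 + 1) - g 0| +
          ∑ i ∈ Finset.range d, b (i + 1 + 1) * |g (i + 1 + 1) - g 0 - (g (i + 1) - g 0)|) := by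
          rw [abs_mul]
          gcongr
      _ = _ := by
          simp_rw [sub_sub_sub_cancel_right]
          ring

/-! ### The Grünwald operator -/

lemma cos_sub_cos_mul_cos_sub_cos (h t φ : ℝ) :
    (Real.cos h - Real.cos (φ - t)) * (Real.cos h - Real.cos (φ + t)) =
      (Real.cos (t - h) - Real.cos φ) * (Real.cos (t + h) - Real.cos φ) := by
  rw [Real.cos_sub, Real.cos_add, Real.cos_sub, Real.cos_add]
  linear_combination
    (1 - Real.cos h ^ 2 - Real.sin φ ^ 2) * Real.sin_sq_add_cos_sq t
    + (-1 + Real.cos t ^ 2) * Real.sin_sq_add_cos_sq φ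
    + Real.sin t ^ 2 * Real.sin_sq_add_cos_sq h

/-- The amplitude `sin φ / ((cos (t - h) - cos φ) (cos (t + h) - cos φ))` of `S_{k,n}(t)` as a
function of `φ = θ_k` is decreasing to the right of `t + h`. -/
lemma sin_div_antitone {α β φ ψ : ℝ} (hα : Real.cos φ < α) (hβ : Real.cos φ < β) (hβ1 : β ≤ 1)
    (hφ : 0 ≤ φ) (hφψ : φ ≤ ψ) (hψ : ψ ≤ Real.pi) :
    Real.sin ψ / ((α - Real.cos ψ) * (β - Real.cos ψ)) ≤
      Real.sin φ / ((α - Real.cos φ) * (β - Real.cos φ)) := by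
  have hc : Real.cos ψ ≤ Real.cos φ := Real.cos_le_cos_of_nonneg_of_le_pi hφ hψ hφψ
  have hsφ := Real.sin_nonneg_of_nonneg_of_le_pi hφ (hφψ.trans hψ)
  have hsψ := Real.sin_nonneg_of_nonneg_of_le_pi (hφ.trans hφψ) hψ
  -- `sin x / (1 - cos x) = cot (x / 2)` is decreasing
  have h1 : Real.sin ψ * (1 - Real.cos φ) ≤ Real.sin φ * (1 - Real.cos ψ) := by
    have hd := Real.sin_nonneg_of_nonneg_of_le_pi (sub_nonneg.2 hφψ) (by linarith)
    have e1 := Real.sin_sub ψ φ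
    have e2 : Real.sin ψ = Real.sin (ψ - φ) * Real.cos φ + Real.cos (ψ - φ) * Real.sin φ := by
      rw [← Real.sin_add, sub_add_cancel]
    nlinarith [Real.cos_le_one φ, Real.cos_le_one (ψ - φ)]
  -- `(1 - cos x) / (β - cos x)` is decreasing
  have h2 : (β - Real.cos φ) * (1 - Real.cos ψ) ≤ (β - Real.cos ψ) * (1 - Real.cos φ) := by
    nlinarith
  have h3 : Real.sin ψ * (β - Real.cos φ) ≤ Real.sin φ * (β - Real.cos ψ) := by
    have hp : 0 < 1 - Real.cos ψ := by linarith
    refine le_of_mul_le_mul_right ?_ hp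
    nlinarith [mul_le_mul_of_nonneg_left h2 hsψ,
      mul_le_mul_of_nonneg_left h1 (by linarith : 0 ≤ β - Real.cos ψ)]
  rw [div_le_div_iff₀ (mul_pos (by linarith) (by linarith))
    (mul_pos (by linarith) (by linarith))]
  have h4 : α - Real.cos φ ≤ α - Real.cos ψ := by linarith
  calc _ = Real.sin ψ * (β - Real.cos φ) * (α - Real.cos φ) := by ring
    _ ≤ Real.sin φ * (β - Real.cos ψ) * (α - Real.cos ψ) := by
        apply mul_le_mul h3 h4 (by linarith)
        exact mul_nonneg hsφ (by linarith)
    _ = _ := by ring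

lemma abs_cos_sub_cos_le_sin {a : ℝ} (ha : a ∈ Icc 0 Real.pi) (b : ℝ) :
    |Real.cos a - Real.cos b| ≤ Real.sin a * |a - b| + (a - b) ^ 2 / 2 := by
  have hs := Real.sin_nonneg_of_mem_Icc ha
  have e : Real.cos a - Real.cos b =
      Real.cos a * (1 - Real.cos (a - b)) + -(Real.sin a * Real.sin (a - b)) := by
    have : Real.cos b = Real.cos (a - (a - b)) := by rw [sub_sub_cancel]
    rw [this, Real.cos_sub a (a - b)]
    ring
  have h1 : |1 - Real.cos (a - b)| ≤ (a - b) ^ 2 / 2 := by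
    rw [abs_of_nonneg (by linarith [Real.cos_le_one (a - b)])]
    linarith [Real.one_sub_sq_div_two_le_cos (x := a - b)]
  rw [e]
  refine (abs_add_le _ _).trans ?_
  rw [abs_neg, abs_mul, abs_mul, abs_of_nonneg hs, add_comm]
  have h2 : |Real.sin (a - b)| ≤ |a - b| := by
    simpa using Real.abs_sin_sub_sin_le (a - b) 0
  have h3 : |Real.cos a| * |1 - Real.cos (a - b)| ≤ 1 * ((a - b) ^ 2 / 2) := by
    gcongr
    exact Real.abs_cos_le_one a
  have h4 : Real.sin a * |Real.sin (a - b)| ≤ Real.sin a * |a - b| := by gcongr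
  linarith

lemma abs_cos_sub_cos_le_of_near {n : ℕ} (hn : 1 ≤ n) {θ Δ : ℝ} (hθ : θ ∈ Icc 0 Real.pi)
    (h1 : Real.sin θ / n ≤ Δ) (h2 : 1 / (n : ℝ) ^ 2 ≤ Δ) {a : ℝ}
    (ha : |θ - a| ≤ 4 * halfStep n) :
    |Real.cos θ - Real.cos a| ≤ 27 * Δ := by
  have hn' : (n : ℝ) ≠ 0 := by positivity
  have hh := halfStep_pos hn
  have hs := Real.sin_nonneg_of_mem_Icc hθ
  have hpi := Real.pi_pos
  have e1 : Real.sin θ * (4 * halfStep n) = 2 * Real.pi * (Real.sin θ / n) := by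
    unfold halfStep; field_simp; ring
  have e2 : 8 * halfStep n ^ 2 = 2 * Real.pi ^ 2 * (1 / (n : ℝ) ^ 2) := by
    unfold halfStep; field_simp; ring
  have hsq : (θ - a) ^ 2 / 2 ≤ 8 * halfStep n ^ 2 := by
    nlinarith [sq_abs (θ - a), abs_nonneg (θ - a)]
  have hΔ : 0 ≤ Δ := le_trans (by positivity) h2
  have hp : Real.pi ^ 2 ≤ 10 := by nlinarith [Real.pi_lt_d2]
  calc _ ≤ Real.sin θ * |θ - a| + (θ - a) ^ 2 / 2 := abs_cos_sub_cos_le_sin hθ a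
    _ ≤ Real.sin θ * (4 * halfStep n) + 8 * halfStep n ^ 2 := by gcongr
    _ ≤ 2 * Real.pi * Δ + 2 * Real.pi ^ 2 * Δ := by
        rw [e1, e2]
        gcongr
    _ ≤ _ := by nlinarith [Real.pi_lt_d2]

/-- One step of the summation by parts: the oscillation of `f` between neighbouring nodes is
absorbed by the decay of `S_{k,n}`. -/
lemma abs_grunwaldFun_mul_abs_sub_le {n k : ℕ} (hk : k ∈ Finset.Icc 1 n)
    (hk1 : k + 1 ∈ Finset.Icc 1 n) {θ Δ W : ℝ} (hθ : θ ∈ Icc 0 Real.pi)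
    (h1 : Real.sin θ / n ≤ Δ) (h2 : 1 / (n : ℝ) ^ 2 ≤ Δ) (hW : 0 ≤ W) {f : ℝ → ℝ}
    (hf : ∀ a ∈ Icc 0 Real.pi, ∀ b ∈ Icc 0 Real.pi,
      |f a - f b| ≤ (1 + |Real.cos a - Real.cos b| / Δ) * W)
    (hy : θ + 2 * halfStep n ≤ chebAngle n k) :
    |grunwaldFun n (k + 1) θ| * |f (chebAngle n (k + 1)) - f (chebAngle n k)| ≤
      1800 * W * cauchyWeight (halfStep n) (chebAngle n (k + 1) - θ) := by
  have hn : 1 ≤ n := (Finset.mem_Icc.1 hk).1.trans (Finset.mem_Icc.1 hk).2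
  have hn' : (0 : ℝ) < n := by exact_mod_cast hn
  have hh := halfStep_pos hn
  have hΔ : 0 < Δ := lt_of_lt_of_le (by positivity) h2
  have hstep : chebAngle n (k + 1) - chebAngle n k = 2 * halfStep n := by
    rw [chebAngle_eq, chebAngle_eq]; push_cast; ring
  have hy1 : 2 * halfStep n ≤ |chebAngle n (k + 1) - θ| :=
    le_trans (by linarith) (le_abs_self _)
  have hD := abs_grunwaldFun_mul_sin_le hk1 hθ hy1 ((div_le_iff₀ hn').1 h1)
  have hw := abs_grunwaldFun_le hk1 hθ
  have hc := abs_cos_sub_cos_le_sin (chebAngle_mem hk1).1 (chebAngle n k)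
  rw [hstep, abs_of_pos (show 0 < 2 * halfStep n by positivity)] at hc
  have e2 : (2 * halfStep n) ^ 2 / 2 ≤ 5 * Δ := by
    have e : (2 * halfStep n) ^ 2 / 2 = Real.pi ^ 2 / 2 * (1 / (n : ℝ) ^ 2) := by
      unfold halfStep; field_simp
    have hp : Real.pi ^ 2 ≤ 10 := by nlinarith [Real.pi_lt_d2, Real.pi_pos]
    rw [e]
    calc _ ≤ Real.pi ^ 2 / 2 * Δ := by gcongr
      _ ≤ _ := by nlinarith
  set w := cauchyWeight (halfStep n) (chebAngle n (k + 1) - θ)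
  have hw0 : 0 < w := cauchyWeight_pos _ _
  set S := |grunwaldFun n (k + 1) θ|
  have hS0 : 0 ≤ S := abs_nonneg _
  set s := Real.sin (chebAngle n (k + 1))
  have key : S * |Real.cos (chebAngle n (k + 1)) - Real.cos (chebAngle n k)| ≤ 1675 * w * Δ := by
    calc _ ≤ S * (s * (2 * halfStep n) + 5 * Δ) := by
          gcongr
          linarith
      _ = S * s * (2 * halfStep n) + 5 * Δ * S := by ring
      _ ≤ 500 * (Δ * n) * w * (2 * halfStep n) + 5 * Δ * (15 * w) := by gcongr
      _ = (1000 * (n * halfStep n) + 75) * (w * Δ) := by ring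
      _ ≤ 1675 * (w * Δ) := by
          rw [nat_mul_halfStep hn]
          gcongr
          linarith [Real.pi_lt_d2]
      _ = _ := by ring
  calc _ ≤ S * ((1 + |Real.cos (chebAngle n (k + 1)) - Real.cos (chebAngle n k)| / Δ) * W) := by
        gcongr
        exact hf _ (chebAngle_mem hk1).1 _ (chebAngle_mem hk).1
    _ = (S + S * |Real.cos (chebAngle n (k + 1)) - Real.cos (chebAngle n k)| / Δ) * W := by ring
    _ ≤ (15 * w + 1675 * w) * W := by
        gcongr
        rw [div_le_iff₀ hΔ]
        exact key
    _ ≤ _ := by nlinarith [mul_nonneg hW hw0.le]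

/-- The contribution of the nodes to the right of `θ`, where `S_{k,n}(θ)` alternates in sign and
decreases in absolute value. -/
lemma abs_sum_right_le {n : ℕ} (hn : 1 ≤ n) {θ Δ W : ℝ} (hθ : θ ∈ Icc 0 Real.pi)
    (h1 : Real.sin θ / n ≤ Δ) (h2 : 1 / (n : ℝ) ^ 2 ≤ Δ) (hW : 0 ≤ W) {f : ℝ → ℝ}
    (hf : ∀ a ∈ Icc 0 Real.pi, ∀ b ∈ Icc 0 Real.pi,
      |f a - f b| ≤ (1 + |Real.cos a - Real.cos b| / Δ) * W) :
    |∑ k ∈ Finset.Icc 1 n with θ + 2 * halfStep n ≤ chebAngle n k,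
      grunwaldFun n k θ * (f (chebAngle n k) - f θ)| ≤ 9100 * W := by
  have hn' : (0 : ℝ) < n := by exact_mod_cast hn
  have hh := halfStep_pos hn
  have hΔ : 0 < Δ := lt_of_lt_of_le (by positivity) h2
  -- the index of the first node in question
  set m := ⌈(θ / halfStep n + 3) / 2⌉₊ with hm
  have hθh : 0 ≤ θ / halfStep n := div_nonneg hθ.1 hh.le
  have hθe : θ / halfStep n * halfStep n = θ := div_mul_cancel₀ _ hh.ne'
  have hmiff (k : ℕ) : θ + 2 * halfStep n ≤ chebAngle n k ↔ m ≤ k := by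
    rw [hm, Nat.ceil_le, chebAngle_eq]
    constructor <;> intro h
    · have : (θ / halfStep n + 2) * halfStep n ≤ (2 * k - 1) * halfStep n := by linarith
      linarith [le_of_mul_le_mul_right this hh]
    · nlinarith
  have hm1 : 1 ≤ m := by
    rw [hm, Nat.one_le_ceil_iff]
    linarith
  have hm2 : chebAngle n m ≤ θ + 4 * halfStep n := by
    have := Nat.ceil_lt_add_one (show 0 ≤ (θ / halfStep n + 3) / 2 by linarith)
    rw [← hm] at this
    rw [chebAngle_eq]
    nlinarith
  rcases lt_or_ge n m with hnm | hnm
  · rw [Finset.filter_eq_empty_iff.2, Finset.sum_empty, abs_zero]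
    · positivity
    · intro k hk
      rw [hmiff]
      have := (Finset.mem_Icc.1 hk).2
      omega
  obtain ⟨d, hd⟩ := Nat.exists_eq_add_of_le hnm
  have hset : (Finset.Icc 1 n).filter (fun k => θ + 2 * halfStep n ≤ chebAngle n k) =
      Finset.Ico m (m + d + 1) := by
    ext k
    rw [Finset.mem_filter, Finset.mem_Icc, Finset.mem_Ico, hmiff]
    omega
  have hmem {i : ℕ} (hi : i ≤ d) : m + i ∈ Finset.Icc 1 n := by
    rw [Finset.mem_Icc]
    omega
  have hfar (i : ℕ) : θ + 2 * halfStep n ≤ chebAngle n (m + i) := (hmiff _).2 (by omega)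
  set α := Real.cos (θ - halfStep n) with hα
  set β := Real.cos (θ + halfStep n) with hβ
  have hαlt {i : ℕ} (hi : i ≤ d) : Real.cos (chebAngle n (m + i)) < α := by
    rw [hα, ← Real.cos_abs (θ - halfStep n)]
    refine Real.cos_lt_cos_of_nonneg_of_le_pi (abs_nonneg _) (chebAngle_mem (hmem hi)).1.2 ?_
    rw [abs_lt]
    constructor <;> linarith [hfar i, hθ.1]
  have hβlt {i : ℕ} (hi : i ≤ d) : Real.cos (chebAngle n (m + i)) < β :=
    Real.cos_lt_cos_of_nonneg_of_le_pi (by linarith [hθ.1]) (chebAngle_mem (hmem hi)).1.2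
      (by linarith [hfar i])
  set b : ℕ → ℝ := fun i => Real.sin (chebAngle n (m + i)) /
    ((α - Real.cos (chebAngle n (m + i))) * (β - Real.cos (chebAngle n (m + i)))) with hb
  set c := Real.sin (n * θ) * Real.sin θ * Real.sin (halfStep n) / n with hc
  have hb0 : ∀ i ≤ d, 0 ≤ b i := fun i hi =>
    div_nonneg (chebAngle_mem (hmem hi)).2.le
      (mul_nonneg (sub_nonneg.2 (hαlt hi).le) (sub_nonneg.2 (hβlt hi).le))
  have hbanti : ∀ i < d, b (i + 1) ≤ b i := by
    intro i hi
    refine sin_div_antitone (hαlt hi.le) (hβlt hi.le) (Real.cos_le_one _)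
      (chebAngle_mem (hmem hi.le)).1.1 ?_ (chebAngle_mem (hmem hi)).1.2
    rw [chebAngle_eq, chebAngle_eq]
    push_cast
    gcongr
    linarith
  have hS {i : ℕ} (hi : i ≤ d) :
      grunwaldFun n (m + i) θ = (-1) ^ m * c * ((-1) ^ i * b i) := by
    have key := grunwaldFun_mul (hmem hi) θ
    have hX : (α - Real.cos (chebAngle n (m + i))) * (β - Real.cos (chebAngle n (m + i))) ≠ 0 :=
      (mul_pos (sub_pos.2 (hαlt hi)) (sub_pos.2 (hβlt hi))).ne'
    rw [cos_sub_cos_mul_cos_sub_cos, ← hα, ← hβ, ← eq_div_iff hX, ← hc, pow_add] at key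
    rw [key, hb]
    ring
  have hSabs {i : ℕ} (hi : i ≤ d) : |grunwaldFun n (m + i) θ| = |c| * b i := by
    rw [hS hi]
    simp [abs_mul, abs_of_nonneg (hb0 i hi)]
  rw [hset, Finset.sum_Ico_eq_sum_range, show m + d + 1 - m = d + 1 by omega]
  set g : ℕ → ℝ := fun i => f (chebAngle n (m + i)) - f θ with hg
  have e : ∑ i ∈ Finset.range (d + 1),
      grunwaldFun n (m + i) θ * (f (chebAngle n (m + i)) - f θ) =
        (-1) ^ m * c * ∑ i ∈ Finset.range (d + 1), (-1) ^ i * b i * g i := by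
    rw [Finset.mul_sum]
    refine Finset.sum_congr rfl fun i hi => ?_
    rw [hS (by have := Finset.mem_range.1 hi; omega)]
    ring
  have hfirst : |grunwaldFun n m θ| * |g 0| ≤ 84 * W := by
    have hcos := abs_cos_sub_cos_le_of_near hn hθ h1 h2 (a := chebAngle n m)
      (by rw [abs_le]; constructor <;> linarith [(hmiff m).2 le_rfl])
    have hq : |Real.cos (chebAngle n m) - Real.cos θ| / Δ ≤ 27 := by
      rw [div_le_iff₀ hΔ, abs_sub_comm]
      exact hcos
    calc _ ≤ 3 * ((1 + 27) * W) := by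
          gcongr
          · exact abs_grunwaldFun_le_three (hmem (Nat.zero_le d)) θ
          · refine (hf _ (chebAngle_mem (hmem (Nat.zero_le d))).1 _ hθ).trans ?_
            gcongr
            exact hq
      _ = _ := by ring
  have hrest : ∑ i ∈ Finset.range d, |grunwaldFun n (m + (i + 1)) θ| * |g (i + 1) - g i| ≤
      9000 * W := by
    calc _ ≤ ∑ i ∈ Finset.range d, 1800 * W *
          cauchyWeight (halfStep n) (chebAngle n (m + 1 + i) - θ) := by
          refine Finset.sum_le_sum fun i hi => ?_
          have hi' := Finset.mem_range.1 hi
          have := abs_grunwaldFun_mul_abs_sub_le (hmem hi'.le) (hmem (i := i + 1) hi') hθ h1 h2 hW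
            hf (hfar i)
          rw [hg]
          simp only [sub_sub_sub_cancel_right]
          rw [show m + 1 + i = m + i + 1 by omega]
          exact this
      _ = 1800 * W * ∑ k ∈ Finset.Ico (m + 1) (m + d + 1),
            cauchyWeight (halfStep n) (chebAngle n k - θ) := by
          rw [Finset.sum_Ico_eq_sum_range, ← Finset.mul_sum,
            show m + d + 1 - (m + 1) = d by omega]
      _ ≤ 1800 * W * ∑ k ∈ Finset.Icc 1 n, cauchyWeight (halfStep n) (chebAngle n k - θ) := by
          refine mul_le_mul_of_nonneg_left (Finset.sum_le_sum_of_subset_of_nonneg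
            (fun k hk => ?_) fun k _ _ => (cauchyWeight_pos _ _).le) (by positivity)
          rw [Finset.mem_Ico] at hk
          rw [Finset.mem_Icc]
          omega
      _ ≤ 1800 * W * 5 := by
          gcongr
          exact sum_cauchyWeight_le hn θ
      _ = _ := by ring
  rw [e, abs_mul, abs_mul, abs_pow, abs_neg, abs_one, one_pow, one_mul]
  calc _ ≤ |c| * (b 0 * |g 0| + ∑ i ∈ Finset.range d, b (i + 1) * |g (i + 1) - g i|) := by
        gcongr
        exact abs_sum_alternating_mul_le hb0 hbanti
    _ = |grunwaldFun n m θ| * |g 0| +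
        ∑ i ∈ Finset.range d, |grunwaldFun n (m + (i + 1)) θ| * |g (i + 1) - g i| := by
        rw [mul_add, Finset.mul_sum, ← mul_assoc, ← hSabs (Nat.zero_le d)]
        congr 1
        refine Finset.sum_congr rfl fun i hi => ?_
        rw [← mul_assoc, ← hSabs (i := i + 1) (Finset.mem_range.1 hi)]
    _ ≤ 84 * W + 9000 * W := add_le_add hfirst hrest
    _ ≤ _ := by linarith

/-- The contribution of the nodes to the left of `θ`, by the reflection `θ ↦ π - θ`. -/
lemma abs_sum_left_le {n : ℕ} (hn : 1 ≤ n) {θ Δ W : ℝ} (hθ : θ ∈ Icc 0 Real.pi)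
    (h1 : Real.sin θ / n ≤ Δ) (h2 : 1 / (n : ℝ) ^ 2 ≤ Δ) (hW : 0 ≤ W) {f : ℝ → ℝ}
    (hf : ∀ a ∈ Icc 0 Real.pi, ∀ b ∈ Icc 0 Real.pi,
      |f a - f b| ≤ (1 + |Real.cos a - Real.cos b| / Δ) * W) :
    |∑ k ∈ Finset.Icc 1 n with chebAngle n k ≤ θ - 2 * halfStep n,
      grunwaldFun n k θ * (f (chebAngle n k) - f θ)| ≤ 9100 * W := by
  have hrefl {a : ℝ} (ha : a ∈ Icc 0 Real.pi) : Real.pi - a ∈ Icc 0 Real.pi :=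
    ⟨sub_nonneg.2 ha.2, sub_le_self _ ha.1⟩
  have h := abs_sum_right_le hn (hrefl hθ) (by rwa [Real.sin_pi_sub]) h2 hW
    (f := fun t => f (Real.pi - t)) fun a ha b hb => by
      have := hf _ (hrefl ha) _ (hrefl hb)
      rwa [Real.cos_pi_sub, Real.cos_pi_sub, neg_sub_neg, abs_sub_comm (Real.cos b)] at this
  convert h using 2
  refine Finset.sum_nbij' (fun k => n + 1 - k) (fun k => n + 1 - k) ?_ ?_ ?_ ?_ ?_
  · intro k hk
    rw [Finset.mem_filter] at hk ⊢
    refine ⟨reflect_mem hk.1, ?_⟩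
    rw [chebAngle_reflect hk.1]
    linarith [hk.2]
  · intro k hk
    rw [Finset.mem_filter] at hk ⊢
    refine ⟨reflect_mem hk.1, ?_⟩
    rw [chebAngle_reflect hk.1]
    linarith [hk.2]
  · intro k hk
    have := Finset.mem_Icc.1 (Finset.mem_filter.1 hk).1
    omega
  · intro k hk
    have := Finset.mem_Icc.1 (Finset.mem_filter.1 hk).1
    omega
  · intro k hk
    have hk' := (Finset.mem_filter.1 hk).1
    rw [grunwaldFun_reflect hk', chebAngle_reflect hk', sub_sub_cancel, sub_sub_cancel]

/-- The pointwise estimate for the Grünwald operator `∑ k, f (θ_k) S_{k,n}(θ)`. -/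
lemma abs_sum_grunwaldFun_mul_sub_le {n : ℕ} (hn : 1 ≤ n) {θ Δ W : ℝ} (hθ : θ ∈ Icc 0 Real.pi)
    (h1 : Real.sin θ / n ≤ Δ) (h2 : 1 / (n : ℝ) ^ 2 ≤ Δ) (hW : 0 ≤ W) {f : ℝ → ℝ}
    (hf : ∀ a ∈ Icc 0 Real.pi, ∀ b ∈ Icc 0 Real.pi,
      |f a - f b| ≤ (1 + |Real.cos a - Real.cos b| / Δ) * W) :
    |∑ k ∈ Finset.Icc 1 n, grunwaldFun n k θ * f (chebAngle n k) - f θ| ≤ 21000 * W := by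
  have hh := halfStep_pos hn
  have hΔ : 0 < Δ := lt_of_lt_of_le (by have : (0 : ℝ) < n := by exact_mod_cast hn
                                        positivity) h2
  have e : ∑ k ∈ Finset.Icc 1 n, grunwaldFun n k θ * f (chebAngle n k) - f θ =
      ∑ k ∈ Finset.Icc 1 n, grunwaldFun n k θ * (f (chebAngle n k) - f θ) := by
    simp_rw [mul_sub]
    rw [Finset.sum_sub_distrib, ← Finset.sum_mul, sum_grunwaldFun hn, one_mul]
  set F : ℕ → ℝ := fun k => grunwaldFun n k θ * (f (chebAngle n k) - f θ) with hF
  set R : ℕ → Prop := fun k => θ + 2 * halfStep n ≤ chebAngle n k with hR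
  set L : ℕ → Prop := fun k => chebAngle n k ≤ θ - 2 * halfStep n with hL
  classical
  have hsplit : ∑ k ∈ Finset.Icc 1 n, F k = ∑ k ∈ Finset.Icc 1 n with R k, F k +
      (∑ k ∈ Finset.Icc 1 n with L k, F k +
        ∑ k ∈ Finset.Icc 1 n with ¬ R k ∧ ¬ L k, F k) := by
    rw [← Finset.sum_filter_add_sum_filter_not (Finset.Icc 1 n) R F,
      ← Finset.sum_filter_add_sum_filter_not ((Finset.Icc 1 n).filter fun k => ¬ R k) L F,
      Finset.filter_filter, Finset.filter_filter]
    congr 2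
    refine Finset.sum_congr (Finset.filter_congr fun k _ => ?_) fun _ _ => rfl
    rw [and_iff_right_iff_imp, hL, hR]
    intro hl
    simp only at hl ⊢
    linarith
  have hmid : |∑ k ∈ Finset.Icc 1 n with ¬ R k ∧ ¬ L k, F k| ≤ 28 * W * 75 := by
    calc _ ≤ ∑ k ∈ Finset.Icc 1 n with ¬ R k ∧ ¬ L k, |F k| := Finset.abs_sum_le_sum_abs _ _
      _ ≤ ∑ k ∈ Finset.Icc 1 n with ¬ R k ∧ ¬ L k, 28 * W * |grunwaldFun n k θ| := by
          refine Finset.sum_le_sum fun k hk => ?_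
          obtain ⟨hk1, hk2, hk3⟩ := Finset.mem_filter.1 hk
          simp only [hR, hL, not_le] at hk2 hk3
          have hcos := abs_cos_sub_cos_le_of_near hn hθ h1 h2 (a := chebAngle n k)
            (by rw [abs_le]; constructor <;> linarith)
          have hq : |Real.cos (chebAngle n k) - Real.cos θ| / Δ ≤ 27 := by
            rw [div_le_iff₀ hΔ, abs_sub_comm]
            exact hcos
          rw [hF, abs_mul, mul_comm]
          gcongr
          refine (hf _ (chebAngle_mem hk1).1 _ hθ).trans ?_
          gcongr
          linarith
      _ ≤ ∑ k ∈ Finset.Icc 1 n, 28 * W * |grunwaldFun n k θ| :=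
          Finset.sum_le_sum_of_subset_of_nonneg (Finset.filter_subset _ _)
            fun k _ _ => by positivity
      _ ≤ 28 * W * 75 := by
          rw [← Finset.mul_sum]
          gcongr
          exact sum_abs_grunwaldFun_le hn hθ
  have hright : |∑ k ∈ Finset.Icc 1 n with R k, F k| ≤ 9100 * W := by
    convert abs_sum_right_le hn hθ h1 h2 hW hf
  have hleft : |∑ k ∈ Finset.Icc 1 n with L k, F k| ≤ 9100 * W := by
    convert abs_sum_left_le hn hθ h1 h2 hW hf
  rw [e, hsplit]
  refine (abs_add_le _ _).trans ?_
  refine (add_le_add hright ((abs_add_le _ _).trans (add_le_add hleft hmid))).trans ?_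
  linarith

theorem mainTheorem4 :
    (∃ C : ℝ, 0 < C ∧
      ∀ f : ℝ → ℝ, ContinuousOn f (Set.Icc 0 Real.pi) →
      ∀ n : ℕ, 1 ≤ n →
      ∀ θ ∈ Set.Icc (0 : ℝ) Real.pi, ∀ x : ℝ, x = Real.cos θ →
        |grunwaldDurrmeyer n f θ - f θ| ≤
          C * (modulusOfContinuity (Set.Icc 0 Real.pi) f (firstMoment n θ)
            + modulusOfContinuity (Set.Icc (-1) 1) (f ∘ Real.arccos) (√(1 - x ^ 2) / n)
            + modulusOfContinuity (Set.Icc (-1) 1) (f ∘ Real.arccos) (1 / (n : ℝ) ^ 2))) ∧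
    (∃ C : ℝ, 0 < C ∧
      ∀ n : ℕ, 1 ≤ n → ∀ θ ∈ Set.Icc (0 : ℝ) Real.pi,
        firstMoment n θ ≤ C * ((1 + Real.log n) / n)) := by
  refine ⟨⟨21000, by norm_num, ?_⟩, ⟨2250, by norm_num, fun n hn θ hθ => firstMoment_le hn hθ⟩⟩
  rintro f hf n hn θ hθ x rfl
  have hn' : (0 : ℝ) < n := by exact_mod_cast hn
  have hsin : √(1 - Real.cos θ ^ 2) = Real.sin θ := by
    rw [← Real.abs_sin_eq_sqrt_one_sub_cos_sq, abs_of_nonneg (Real.sin_nonneg_of_mem_Icc hθ)]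
  rw [hsin]
  have hg : ContinuousOn (f ∘ Real.arccos) (Icc (-1) 1) :=
    hf.comp Real.continuous_arccos.continuousOn fun y _ => ⟨Real.arccos_nonneg y, Real.arccos_le_pi y⟩
  set ω : ℝ → ℝ := modulusOfContinuity (Icc (-1) 1) (f ∘ Real.arccos) with hω
  have hω0 (δ : ℝ) : 0 ≤ ω δ := modulusOfContinuity_nonneg _ _ _
  set Δ := max (Real.sin θ / n) (1 / (n : ℝ) ^ 2) with hΔdef
  have hΔ : 0 < Δ := lt_of_lt_of_le (by positivity) (le_max_right _ _)
  have hωΔ : ω Δ ≤ ω (Real.sin θ / n) + ω (1 / (n : ℝ) ^ 2) := by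
    rcases max_choice (Real.sin θ / n) (1 / (n : ℝ) ^ 2) with h | h <;> rw [hΔdef, h]
    · linarith [hω0 (1 / (n : ℝ) ^ 2)]
    · linarith [hω0 (Real.sin θ / n)]
  have h1 := abs_sum_grunwaldFun_mul_sub_le hn hθ (le_max_left _ _) (le_max_right _ _) (hω0 Δ)
    (f := f) fun a ha b hb => by
      have := abs_sub_le_mul_modulusOfContinuity hg hΔ
        (Real.cos_mem_Icc a) (Real.cos_mem_Icc b)
      simpa only [Function.comp_apply, Real.arccos_cos ha.1 ha.2, Real.arccos_cos hb.1 hb.2]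
        using this
  have h2 := abs_grunwaldDurrmeyer_sub_sum_le hn hf hθ
  have h3 := modulusOfContinuity_nonneg (Icc 0 Real.pi) f (firstMoment n θ)
  refine (abs_sub_le _ (∑ k ∈ Finset.Icc 1 n, grunwaldFun n k θ * f (chebAngle n k)) _).trans ?_
  linarith
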